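/- Let $R$ be a quadriculated planar region, i.e. a finite union of unit squares of the grid $\mathbb{Z}^2$ (not necessarily simply connected), with squares coloured black and white as a checkerboard. A domino is a union of two unit squares with a common side. Let $T$ be the graph whose vertices are the domino tilings of $R$, two tilings being adjacent iff they differ by a flip (two dominoes forming a $2\times 2$ square are lifted and placed back rotated by $90^\circ$); let $d$ be its graph distance. Let $\mathcal{T}$ be the cube complex obtained from $T$ by gluing a $k$-cube for every tiling and every set of $k$ independent flips of it, i.e. flips acting on $2\times2$ squares no two of which share a unit square; the vertices of the cube are the $2^k$ tilings obtained by performing a subset of these flips, and cubes with the same vertices are the same. A cut is a simple oriented path of edges of $R$ whose endpoints lie in different connected components of the boundary of $R$. The flow of a tiling across a cut is the number of dominoes crossing the cut, each counted with sign $+1$ or $-1$ according to whether its square to the left of the cut is black or white. A height bundle is a bundle over $R$ with fibre $\mathbb{Z}$, whose leaves over simply connected pieces are labelled by integers, labellings being glued by translations. A height section of a tiling $t$ is a section $\theta$ of such a bundle over the vertices of $R$ such that, relative to the leaves, along each oriented edge of $R$ not crossed by a domino of $t$, $\theta$ increases by $1$ if the square to the left is black and decreases by $1$ if it is white. Then: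 1. Two tilings $t_1,t_2$ of $R$ belong to the same connected component of $T$ if and only if their flows coincide across all cuts. 2. All tilings of $R$ have height sections in one common height bundle, which can be chosen so that for any two tilings in the same connected component of $T$ they coincide on the boundary of $R$. If $t_1,t_2$ lie in the same connected component of $T$ and $\theta_1,\theta_2$ are height sections of $t_1,t_2$ in the same height bundle that coincide on the boundary of $R$, then $$d(t_1,t_2)=\frac14\sum_{v}|\theta_1(v)-\theta_2(v)|,$$ where $v$ runs over the vertices of $R$. 3. Every connected component of $\mathcal{T}$ is contractible. -/

import Mathlib

namespace DominoFlip

/-- The unit square `[x, x+1] × [y, y+1]` of the plane is named by its lower left corner `(x, y)`.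
A quadriculated planar region is a finite set of unit squares, `R : Finset Cell`. -/
abbrev Cell : Type := ℤ × ℤ

/-- Vertices of the square grid. -/
abbrev Vertex : Type := ℤ × ℤ

/-- Checkerboard colouring: `1` on black squares, `-1` on white squares. -/
def colour (c : Cell) : ℤ := if Even (c.1 + c.2) then 1 else -1

/-- A domino: two unit squares with a common side (horizontal or vertical). -/
def IsDomino (d : Finset Cell) : Prop :=
  ∃ c : Cell, d = {c, c + (1, 0)} ∨ d = {c, c + (0, 1)}

/-- A domino tiling of `R`: a set of dominoes contained in `R` such that every square of `R` lies
in exactly one of them. -/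
@[ext]
structure Tiling (R : Finset Cell) where
  dominoes : Finset (Finset Cell)
  isDomino : ∀ d ∈ dominoes, IsDomino d
  subset : ∀ d ∈ dominoes, d ⊆ R
  cover : ∀ c ∈ R, ∃! d, d ∈ dominoes ∧ c ∈ d

/-- The two horizontal dominoes that form the 2 × 2 square with lower left unit square `c`. -/
def horizontalPair (c : Cell) : Finset (Finset Cell) :=
  {{c, c + (1, 0)}, {c + (0, 1), c + (1, 1)}}

/-- The two vertical dominoes that form the 2 × 2 square with lower left unit square `c`. -/
def verticalPair (c : Cell) : Finset (Finset Cell) :=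
  {{c, c + (0, 1)}, {c + (1, 0), c + (1, 1)}}

/-- The flip graph `T`: two tilings are adjacent iff they differ by lifting two dominoes that
form a 2 × 2 square and placing them back rotated by 90 degrees. -/
def flipGraph (R : Finset Cell) : SimpleGraph (Tiling R) :=
  SimpleGraph.fromRel fun t t' => ∃ c : Cell,
    horizontalPair c ⊆ t.dominoes ∧ verticalPair c ⊆ t'.dominoes ∧
      t.dominoes \ horizontalPair c = t'.dominoes \ verticalPair c

/-! ### Edges, boundary, cuts and flows -/

/-- The unit square to the left of the oriented grid edge from `v` to `w`
(the four cases are: east, north, west, south). The square to its right is `leftCell w v`. -/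
def leftCell (v w : Vertex) : Cell :=
  if w.1 = v.1 + 1 then (v.1, v.2)
  else if w.2 = v.2 + 1 then (v.1 - 1, v.2)
  else if w.1 = v.1 - 1 then (v.1 - 1, v.2 - 1)
  else (v.1, v.2 - 1)

/-- The graph of the square grid `ℤ²`. -/
def gridGraph : SimpleGraph Vertex where
  Adj v w := |w.1 - v.1| + |w.2 - v.2| = 1
  symm := ⟨fun v w h => by rwa [abs_sub_comm v.1, abs_sub_comm v.2]⟩
  loopless := ⟨fun v h => by simp at h⟩

/-- The vertices of `R`: the corners of its squares. -/
def vertices (R : Finset Cell) : Finset Vertex :=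
  R.biUnion fun c => {c, c + (1, 0), c + (0, 1), c + (1, 1)}

/-- The graph of edges of `R`: grid edges with a square of `R` on at least one side. -/
def edgeGraph (R : Finset Cell) : SimpleGraph Vertex where
  Adj v w := gridGraph.Adj v w ∧ (leftCell v w ∈ R ∨ leftCell w v ∈ R)
  symm := ⟨fun _ _ h => ⟨h.1.symm, h.2.symm⟩⟩
  loopless := ⟨fun _ h => gridGraph.irrefl h.1⟩

/-- The boundary of `R`: grid edges with a square of `R` on exactly one side. -/
def boundaryGraph (R : Finset Cell) : SimpleGraph Vertex where
  Adj v w := gridGraph.Adj v w ∧ Xor (leftCell v w ∈ R) (leftCell w v ∈ R)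
  symm := ⟨fun _ _ h => ⟨h.1.symm, (xor_comm _ _).mp h.2⟩⟩
  loopless := ⟨fun _ h => gridGraph.irrefl h.1⟩

/-- Vertices on the boundary of `R`. -/
def IsBoundaryVertex (R : Finset Cell) (v : Vertex) : Prop :=
  ∃ w, (boundaryGraph R).Adj v w

/-- A cut: a simple oriented path of edges of `R` whose endpoints lie in different connected
components of the boundary of `R`. -/
def IsCut {R : Finset Cell} {u v : Vertex} (p : (edgeGraph R).Walk u v) : Prop :=
  p.IsPath ∧ IsBoundaryVertex R u ∧ IsBoundaryVertex R v ∧ ¬ (boundaryGraph R).Reachable u v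

/-- The edge `vw` is crossed by (is the middle segment of) a domino of `t`. -/
def Tiling.Crosses {R : Finset Cell} (t : Tiling R) (v w : Vertex) : Prop :=
  ({leftCell v w, leftCell w v} : Finset Cell) ∈ t.dominoes

instance {R : Finset Cell} (t : Tiling R) (v w : Vertex) : Decidable (t.Crosses v w) :=
  inferInstanceAs (Decidable (_ ∈ t.dominoes))

/-- The flow of `t` across an oriented path: the number of dominoes crossing it, each counted
with the sign of the colour of its square to the left of the path. -/
def Tiling.flow {R : Finset Cell} (t : Tiling R) {u v : Vertex} (p : (edgeGraph R).Walk u v) : ℤ :=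
  (p.darts.map fun e => if t.Crosses e.fst e.snd then colour (leftCell e.fst e.snd) else 0).sum

/-! ### Height sections -/

/-- A bundle over `R` with fibre `ℤ` whose leaves over simply connected pieces are labelled by
the integers, in coordinates: the fibre over each vertex is identified with `ℤ`, and along the
oriented edge `vw` the leaf through `n` over `v` continues to the leaf through `n + shift v w`
over `w`. Leaves close up around every square of `R`. -/
structure HeightBundle (R : Finset Cell) where
  shift : Vertex → Vertex → ℤ
  shift_symm : ∀ v w, (edgeGraph R).Adj v w → shift w v = -shift v w
  flat : ∀ c ∈ R, shift c (c + (1, 0)) + shift (c + (1, 0)) (c + (1, 1)) +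
    shift (c + (1, 1)) (c + (0, 1)) + shift (c + (0, 1)) c = 0

/-- `θ` is a height section of `t` in the bundle `L`: in terms of the leaves of `L`, along every
oriented edge of `R` not crossed by a domino of `t` the height increases by `1` if the square to
the left is black and decreases by `1` if it is white. (For the one crossed edge of a square the
change, `∓3`, follows by going around that square.) -/
def IsHeightSection {R : Finset Cell} (L : HeightBundle R) (t : Tiling R) (θ : Vertex → ℤ) : Prop :=
  ∀ v w, (edgeGraph R).Adj v w → ¬ t.Crosses v w →
    θ w = θ v + L.shift v w + colour (leftCell v w)

/-! ### The complex of flips -/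

/-- The unit squares covered by the dominoes lifted when passing from `t` to `t'`; if `t`, `t'`
differ by a flip, this is the 2 × 2 square on which the flip acts. -/
def flipSquare {R : Finset Cell} (t t' : Tiling R) : Finset Cell :=
  (t.dominoes \ t'.dominoes).biUnion id

/-- `S` is a set of independent flips of `t`, a flip being named by the tiling it leads to: the
flips in `S` act on pairwise disjoint 2 × 2 squares. -/
def IndependentFlips {R : Finset Cell} (t : Tiling R) (S : Finset (Tiling R)) : Prop :=
  (∀ t' ∈ S, (flipGraph R).Adj t t') ∧
    (S : Set (Tiling R)).Pairwise fun t' t'' => Disjoint (flipSquare t t') (flipSquare t t'')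

/-- The 0-cell of the tiling `t`: the indicator function of its set of dominoes. -/
def Tiling.point {R : Finset Cell} (t : Tiling R) : Finset Cell → ℝ :=
  fun d => if d ∈ t.dominoes then 1 else 0

/-- The characteristic map of the `k`-cell of `k` independent flips `S` of `t`, on the cube
`[0,1]^S`: the coordinate `a t'` tells how far the flip from `t` to `t'` has been carried out.
Its values at the `2^k` vertices of the cube are the 0-cells of the tilings obtained from `t` by
performing a subset of the flips. -/
noncomputable def cellMap {R : Finset Cell} (t : Tiling R) (S : Finset (Tiling R))
    (a : Tiling R → ℝ) : Finset Cell → ℝ :=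
  t.point + ∑ t' ∈ S, a t' • (t'.point - t.point)

/-- The complex `𝒯`: the union of all the cubes of independent flips, realized in the space of
real functions on dominoes. These finitely many cubes are embedded by their characteristic maps and
meet exactly in common faces, so that this is the cube complex obtained from the
flip graph by gluing one `k`-cube for each set of `k` independent flips. -/
def flipComplex (R : Finset Cell) : Set (Finset Cell → ℝ) :=
  {x | ∃ (t : Tiling R) (S : Finset (Tiling R)), IndependentFlips t S ∧
    ∃ a : Tiling R → ℝ, (∀ t', a t' ∈ Set.Icc (0 : ℝ) 1) ∧ cellMap t S a = x}

end DominoFlip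

open DominoFlip

namespace DominoFlip

/-! The indicator functions of two tilings have the same sum, one, around every square of `R`, and
both vanish on dominoes meeting a square outside `R`. With colour signs, their difference is
therefore the gradient of an integer function on all of ℤ², even when `R` has holes. This is `diff t
t'`, normalized to vanish far to the west; up to the factor -4 it is a difference of height
sections. It is constant along the boundary components of `R`, and its increment along a path is the
difference of the flows (`flow_sub_flow`). Hence equal flows across all cuts amount to
`SameBoundary`: the difference vanishes at every vertex that is not interior
(`sameBoundary_iff_flow_eq`).

A flip changes the height of a tiling by ±1 at one interior vertex (`flipGraph_adj_iff`), so flips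
preserve `SameBoundary`, and the distance is at least `gap`, the sum of |`diff`|. Equality holds
because two distinct tilings with the same boundary heights can always be brought closer by a flip
of one of them. If no vertex of the maximal level set allowed this, each would have a horizontal and
a vertical neighbour in the set along uncrossed edges. Pushing extremal vertices of such a set
westward lowers a positive weight without end (`exists_linked_lt`), which is impossible in a finite
region.

For contractibility, a component of the complex is described by `realHeights t₀`: real functions
that vanish off the interior, keep all domino weights in [0, 1] and take an integer value at an end
of each edge. Rounding such a function up or down, independently at each vertex, gives a tiling, so
each one lies in a cube (`exists_cell_of_mem_realHeights`). The set is closed under pointwise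
minimum and maximum and has a greatest and a least element, joined by a path `γ`; the homotopy
min(h, γ(s)) contracts it. Heights off the interior are integers throughout the complex, hence
constant on its components, so no component exceeds one such set. -/

/-! ### Dominoes and colours in coordinates -/

/-- The horizontal domino whose left square is `(x, y)`. -/
def hd (x y : ℤ) : Finset Cell := {(x, y), (x + 1, y)}

/-- The vertical domino whose lower square is `(x, y)`. -/
def vd (x y : ℤ) : Finset Cell := {(x, y), (x, y + 1)}

lemma mem_hd {x y : ℤ} {c : Cell} : c ∈ hd x y ↔ c = (x, y) ∨ c = (x + 1, y) := by simp [hd]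

lemma mem_vd {x y : ℤ} {c : Cell} : c ∈ vd x y ↔ c = (x, y) ∨ c = (x, y + 1) := by simp [vd]

lemma isDomino_iff {d : Finset Cell} : IsDomino d ↔ ∃ x y, d = hd x y ∨ d = vd x y := by
  simp [IsDomino, hd, vd, Prod.exists]

lemma isDomino_hd (x y : ℤ) : IsDomino (hd x y) := isDomino_iff.2 ⟨x, y, Or.inl rfl⟩

lemma isDomino_vd (x y : ℤ) : IsDomino (vd x y) := isDomino_iff.2 ⟨x, y, Or.inr rfl⟩

lemma hd_inj {x y x' y' : ℤ} : hd x y = hd x' y' ↔ x = x' ∧ y = y' := by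
  refine ⟨fun h => ?_, fun h => by rw [h.1, h.2]⟩
  have h1 : ((x, y) : Cell) ∈ hd x' y' := h ▸ mem_hd.2 (Or.inl rfl)
  have h2 : ((x + 1, y) : Cell) ∈ hd x' y' := h ▸ mem_hd.2 (Or.inr rfl)
  simp only [mem_hd, Prod.mk.injEq] at h1 h2
  omega

lemma vd_inj {x y x' y' : ℤ} : vd x y = vd x' y' ↔ x = x' ∧ y = y' := by
  refine ⟨fun h => ?_, fun h => by rw [h.1, h.2]⟩
  have h1 : ((x, y) : Cell) ∈ vd x' y' := h ▸ mem_vd.2 (Or.inl rfl)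
  have h2 : ((x, y + 1) : Cell) ∈ vd x' y' := h ▸ mem_vd.2 (Or.inr rfl)
  simp only [mem_vd, Prod.mk.injEq] at h1 h2
  omega

lemma hd_ne_vd {x y x' y' : ℤ} : hd x y ≠ vd x' y' := by
  intro h
  have h1 : ((x, y) : Cell) ∈ vd x' y' := h ▸ mem_hd.2 (Or.inl rfl)
  have h2 : ((x + 1, y) : Cell) ∈ vd x' y' := h ▸ mem_hd.2 (Or.inr rfl)
  simp only [mem_vd, Prod.mk.injEq] at h1 h2
  omega

lemma vd_ne_hd {x y x' y' : ℤ} : vd x y ≠ hd x' y' := hd_ne_vd.symm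

lemma IsDomino.eq_of_mem {d : Finset Cell} (hd' : IsDomino d) {x y : ℤ} (h : (x, y) ∈ d) :
    d = hd x y ∨ d = hd (x - 1) y ∨ d = vd x y ∨ d = vd x (y - 1) := by
  obtain ⟨a, b, rfl | rfl⟩ := isDomino_iff.1 hd'
  · simp only [mem_hd, Prod.mk.injEq] at h
    rcases h with ⟨rfl, rfl⟩ | ⟨rfl, rfl⟩ <;> simp
  · simp only [mem_vd, Prod.mk.injEq] at h
    rcases h with ⟨rfl, rfl⟩ | ⟨rfl, rfl⟩ <;> simp

lemma hd_subset {R : Finset Cell} {x y : ℤ} : hd x y ⊆ R ↔ (x, y) ∈ R ∧ (x + 1, y) ∈ R := by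
  simp [hd, Finset.insert_subset_iff]

lemma vd_subset {R : Finset Cell} {x y : ℤ} : vd x y ⊆ R ↔ (x, y) ∈ R ∧ (x, y + 1) ∈ R := by
  simp [vd, Finset.insert_subset_iff]

lemma colour_east (x y : ℤ) : colour (x + 1, y) = -colour (x, y) := by
  unfold colour
  by_cases h : Even (x + y)
  · have : ¬ Even (x + 1 + y) := by rw [Int.even_iff] at *; omega
    simp [h, this]
  · have : Even (x + 1 + y) := by rw [Int.even_iff] at *; omega
    simp [h, this]

lemma colour_north (x y : ℤ) : colour (x, y + 1) = -colour (x, y) := by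
  unfold colour
  by_cases h : Even (x + y)
  · have : ¬ Even (x + (y + 1)) := by rw [Int.even_iff] at *; omega
    simp [h, this]
  · have : Even (x + (y + 1)) := by rw [Int.even_iff] at *; omega
    simp [h, this]

lemma colour_west (x y : ℤ) : colour (x - 1, y) = -colour (x, y) := by
  have := colour_east (x - 1) y
  rw [sub_add_cancel] at this
  omega

lemma colour_south (x y : ℤ) : colour (x, y - 1) = -colour (x, y) := by
  have := colour_north x (y - 1)
  rw [sub_add_cancel] at this
  omega

lemma colour_eq_or (c : Cell) : colour c = 1 ∨ colour c = -1 := by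
  unfold colour; split_ifs <;> simp

lemma colour_mul_self (c : Cell) : colour c * colour c = 1 := by
  rcases colour_eq_or c with h | h <;> simp [h]

lemma colour_mul_self_cast {A : Type*} [CommRing A] (c : Cell) :
    (colour c : A) * (colour c : A) = 1 := by
  exact_mod_cast congrArg (Int.cast : ℤ → A) (colour_mul_self c)

/-! ### Indicator functions of tilings -/

variable {R : Finset Cell}

/-- The indicator function of the set of dominoes of a tiling. -/
def Tiling.ind (t : Tiling R) (d : Finset Cell) : ℤ := if d ∈ t.dominoes then 1 else 0

lemma Tiling.ind_eq_or (t : Tiling R) (d : Finset Cell) : t.ind d = 0 ∨ t.ind d = 1 := by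
  unfold Tiling.ind; split_ifs <;> simp

lemma Tiling.ind_eq_one {t : Tiling R} {d : Finset Cell} : t.ind d = 1 ↔ d ∈ t.dominoes := by
  unfold Tiling.ind; split_ifs <;> simp [*]

lemma Tiling.ind_eq_zero {t : Tiling R} {d : Finset Cell} : t.ind d = 0 ↔ d ∉ t.dominoes := by
  unfold Tiling.ind; split_ifs <;> simp [*]

lemma Tiling.ind_injective : Function.Injective (Tiling.ind : Tiling R → Finset Cell → ℤ) := by
  intro t t' h
  ext d
  rw [← Tiling.ind_eq_one, ← Tiling.ind_eq_one, h]

lemma Tiling.point_apply (t : Tiling R) (d : Finset Cell) : t.point d = (t.ind d : ℝ) := by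
  unfold Tiling.point Tiling.ind; split_ifs <;> simp

lemma Tiling.eq_of_mem (t : Tiling R) {c : Cell} {d d' : Finset Cell} (hd : d ∈ t.dominoes)
    (hd' : d' ∈ t.dominoes) (hc : c ∈ d) (hc' : c ∈ d') : d = d' :=
  (t.cover c (t.subset d hd hc)).unique ⟨hd, hc⟩ ⟨hd', hc'⟩

/-- Weights on dominoes supported on dominoes of `R`. -/
def IsSupported (R : Finset Cell) {A : Type*} [Zero A] (z : Finset Cell → A) : Prop :=
  ∀ d, z d ≠ 0 → IsDomino d ∧ d ⊆ R

/-- The total weight of the four dominoes that cover a given unit square. -/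
def cellSum {A : Type*} [Add A] (z : Finset Cell → A) (x y : ℤ) : A :=
  z (hd x y) + z (hd (x - 1) y) + z (vd x y) + z (vd x (y - 1))

lemma Tiling.isSupported_ind (t : Tiling R) : IsSupported R t.ind := by
  intro d hd
  have : d ∈ t.dominoes := by
    by_contra h
    exact hd (Tiling.ind_eq_zero.2 h)
  exact ⟨t.isDomino d this, t.subset d this⟩

lemma Tiling.cellSum_ind (t : Tiling R) {x y : ℤ} (h : (x, y) ∈ R) : cellSum t.ind x y = 1 := by
  obtain ⟨d, ⟨hd1, hd2⟩, hu⟩ := t.cover _ h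
  have key : ∀ d', (x, y) ∈ d' → t.ind d' = if d' = d then 1 else 0 := by
    intro d' hd'
    unfold Tiling.ind
    by_cases e : d' = d
    · simp [e, hd1]
    · have : d' ∉ t.dominoes := fun h' => e (hu d' ⟨h', hd'⟩)
      simp [e, this]
  unfold cellSum
  rw [key (hd x y) (by simp [mem_hd]), key (hd (x - 1) y) (by simp [mem_hd]),
    key (vd x y) (by simp [mem_vd]), key (vd x (y - 1)) (by simp [mem_vd])]
  have hx : x ≠ x - 1 := by omega
  have hy : y ≠ y - 1 := by omega
  rcases (t.isDomino d hd1).eq_of_mem hd2 with rfl | rfl | rfl | rfl <;>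
    simp [hd_inj, vd_inj, hd_ne_vd, vd_ne_hd, hx, hy]

/-- A `0`-`1` weight on dominoes covering each square once is the indicator of a tiling. -/
lemma exists_tiling_of_weight (z : Finset Cell → ℤ) (h01 : ∀ d, z d = 0 ∨ z d = 1)
    (hs : IsSupported R z) (hsum : ∀ x y, (x, y) ∈ R → cellSum z x y = 1) :
    ∃ t : Tiling R, t.ind = z := by
  classical
  have mem : ∀ d, d ∈ R.powerset.filter (fun d => z d = 1) ↔ z d = 1 := by
    intro d
    simp only [Finset.mem_filter, Finset.mem_powerset, and_iff_right_iff_imp]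
    exact fun h => (hs d (by simp [h])).2
  refine ⟨⟨R.powerset.filter (fun d => z d = 1), ?_, ?_, ?_⟩, ?_⟩
  · intro d h
    exact (hs d (by simp [(mem d).1 h])).1
  · intro d h
    exact (hs d (by simp [(mem d).1 h])).2
  · rintro ⟨x, y⟩ hc
    have h4 := hsum x y hc
    unfold cellSum at h4
    have key : ∀ d, (d ∈ R.powerset.filter (fun d => z d = 1) ∧ (x, y) ∈ d) ↔
        z d = 1 ∧ (d = hd x y ∨ d = hd (x - 1) y ∨ d = vd x y ∨ d = vd x (y - 1)) := by
      intro d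
      rw [mem]
      refine and_congr_right fun h => ⟨fun h' => (hs d (by simp [h])).1.eq_of_mem h', ?_⟩
      rintro (rfl | rfl | rfl | rfl) <;> simp [mem_hd, mem_vd]
    simp only [key]
    rcases h01 (hd x y) with a | a <;> rcases h01 (hd (x - 1) y) with b | b <;>
      rcases h01 (vd x y) with c | c <;> rcases h01 (vd x (y - 1)) with e | e <;>
      first
      | (exfalso; omega)
      | (refine ⟨hd x y, ⟨a, by simp⟩, ?_⟩
         rintro d ⟨h, rfl | rfl | rfl | rfl⟩ <;> first | rfl | omega)
      | (refine ⟨hd (x - 1) y, ⟨b, by simp⟩, ?_⟩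
         rintro d ⟨h, rfl | rfl | rfl | rfl⟩ <;> first | rfl | omega)
      | (refine ⟨vd x y, ⟨c, by simp⟩, ?_⟩
         rintro d ⟨h, rfl | rfl | rfl | rfl⟩ <;> first | rfl | omega)
      | (refine ⟨vd x (y - 1), ⟨e, by simp⟩, ?_⟩
         rintro d ⟨h, rfl | rfl | rfl | rfl⟩ <;> first | rfl | omega)
  · funext d
    unfold Tiling.ind
    simp only [mem]
    rcases h01 d with h | h <;> simp [h]

/-! ### Circulations and potentials -/

/-- Differences of (weighted) tilings: weights supported on the dominoes of `R` with total
weight zero around each square. -/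
structure IsCirculation (R : Finset Cell) {A : Type*} [CommRing A] (z : Finset Cell → A) :
    Prop where
  supported : IsSupported R z
  cellSum_eq_zero : ∀ x y, cellSum z x y = 0

section Circulation

variable {A : Type*} [CommRing A]

lemma IsSupported.hd_eq_zero {z : Finset Cell → A} (hz : IsSupported R z) {x y : ℤ}
    (h : (x, y) ∉ R ∨ (x + 1, y) ∉ R) : z (hd x y) = 0 := by
  by_contra h'
  have := hd_subset.1 (hz _ h').2
  tauto

lemma IsSupported.vd_eq_zero {z : Finset Cell → A} (hz : IsSupported R z) {x y : ℤ}
    (h : (x, y) ∉ R ∨ (x, y + 1) ∉ R) : z (vd x y) = 0 := by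
  by_contra h'
  have := vd_subset.1 (hz _ h').2
  tauto

lemma IsSupported.sub {z w : Finset Cell → A} (hz : IsSupported R z) (hw : IsSupported R w) :
    IsSupported R (z - w) := by
  intro d h
  by_cases hzd : z d = 0
  · exact hw d fun h' => h (by simp [hzd, h'])
  · exact hz d hzd

/-- At a square outside `R` all four terms vanish by support, so the zero sum holds on the whole
plane. This is what lets heights pass over holes. -/
lemma IsCirculation.sub_of {z w : Finset Cell → A} (hz : IsSupported R z) (hw : IsSupported R w)
    (h : ∀ x y, (x, y) ∈ R → cellSum z x y = cellSum w x y) : IsCirculation R (z - w) := by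
  refine ⟨hz.sub hw, fun x y => ?_⟩
  by_cases hc : (x, y) ∈ R
  · have := h x y hc
    simp only [cellSum, Pi.sub_apply] at this ⊢
    linear_combination this
  · have h' := hz.sub hw
    unfold cellSum
    rw [h'.hd_eq_zero (Or.inl hc), h'.hd_eq_zero (Or.inr (by simpa using hc)),
      h'.vd_eq_zero (Or.inl hc), h'.vd_eq_zero (Or.inr (by simpa using hc))]
    simp

lemma isCirculation_ind_sub (t t' : Tiling R) : IsCirculation R (t.ind - t'.ind) :=
  IsCirculation.sub_of t.isSupported_ind t'.isSupported_ind fun x y h => by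
    rw [t.cellSum_ind h, t'.cellSum_ind h]

/-- The height function of a circulation, normalized to vanish far to the west. -/
def potential (R : Finset Cell) (z : Finset Cell → A) (v : Vertex) : A :=
  ∑ c ∈ R with c.2 = v.2 ∧ c.1 < v.1, (colour c : A) * z (vd c.1 (c.2 - 1))

lemma potential_add (z w : Finset Cell → A) :
    potential R (z + w) = potential R z + potential R w := by
  funext v
  simp [potential, mul_add, Finset.sum_add_distrib]

lemma potential_smul (a : A) (z : Finset Cell → A) :
    potential R (a • z) = a • potential R z := by
  funext v
  simp [potential, Finset.mul_sum, mul_left_comm]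

lemma exists_west (R : Finset Cell) : ∃ b : ℤ, ∀ c ∈ R, b ≤ c.1 := by
  rcases R.eq_empty_or_nonempty with rfl | h
  · exact ⟨0, by simp⟩
  · obtain ⟨c, _, hc⟩ := R.exists_min_image Prod.fst h
    exact ⟨c.1, hc⟩

/-- Induction from west to east. -/
lemma west_induction {R : Finset Cell} {P : ℤ → ℤ → Prop}
    (base : ∀ x y, (∀ c ∈ R, x ≤ c.1) → P x y) (step : ∀ x y, P x y → P (x + 1) y) (x y : ℤ) :
    P x y := by
  obtain ⟨b, hb⟩ := exists_west R
  by_cases h : x ≤ b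
  · exact base x y fun c hc => h.trans (hb c hc)
  · obtain ⟨n, rfl⟩ : ∃ n : ℕ, x = b + n := ⟨(x - b).toNat, by omega⟩
    clear h
    induction n with
    | zero => exact base _ y (by simpa using hb)
    | succ n ih =>
      have := step _ _ ih
      push_cast
      rwa [← add_assoc]

lemma potential_eq_zero_of_west (z : Finset Cell → A) {x y : ℤ} (h : ∀ c ∈ R, x ≤ c.1) :
    potential R z (x, y) = 0 := by
  unfold potential
  rw [Finset.filter_false_of_mem, Finset.sum_empty]
  intro c hc hc'
  have := h c hc
  have := hc'.2
  dsimp at this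
  omega

lemma IsSupported.potential_east {z : Finset Cell → A} (hz : IsSupported R z) (x y : ℤ) :
    potential R z (x + 1, y) = potential R z (x, y) + (colour (x, y) : A) * z (vd x (y - 1)) := by
  unfold potential
  by_cases h : (x, y) ∈ R
  · have : (R.filter fun c => c.2 = y ∧ c.1 < x + 1)
        = insert (x, y) (R.filter fun c => c.2 = y ∧ c.1 < x) := by
      ext ⟨a, b⟩
      simp only [Finset.mem_filter, Finset.mem_insert, Prod.mk.injEq]
      constructor
      · rintro ⟨h1, h2, h3⟩
        by_cases hx : a = x
        · exact Or.inl ⟨hx, h2⟩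
        · exact Or.inr ⟨h1, h2, by omega⟩
      · rintro (⟨rfl, rfl⟩ | ⟨h1, h2, h3⟩)
        · exact ⟨h, rfl, by omega⟩
        · exact ⟨h1, h2, by omega⟩
    dsimp only
    rw [this, Finset.sum_insert (by simp)]
    ring
  · have : (R.filter fun c => c.2 = y ∧ c.1 < x + 1) = (R.filter fun c => c.2 = y ∧ c.1 < x) := by
      refine Finset.filter_congr fun c hc => and_congr_right fun h2 => ?_
      have : c.1 ≠ x := fun h1 => h (by rw [← h1, ← h2]; exact hc)
      omega
    dsimp only
    rw [this, hz.vd_eq_zero (Or.inr (by simpa using h))]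
    ring

/-- The potential is built from horizontal steps only; zero total weight around each square makes it
independent of the path, row by row from the west. -/
lemma IsCirculation.potential_north {z : Finset Cell → A} (hz : IsCirculation R z) (x y : ℤ) :
    potential R z (x, y + 1) = potential R z (x, y) - (colour (x, y) : A) * z (hd (x - 1) y) := by
  induction x, y using west_induction (R := R) with
  | base x y h =>
    rw [potential_eq_zero_of_west z h, potential_eq_zero_of_west z h,
      hz.supported.hd_eq_zero (Or.inl fun h' => ?_)]
    · simp
    · have := h _ h'
      dsimp at this
      omega
  | step x y ih =>
    have := hz.cellSum_eq_zero x y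
    rw [hz.supported.potential_east, hz.supported.potential_east, ih, colour_north, colour_east]
    unfold cellSum at this
    simp only [add_sub_cancel_right, Int.cast_neg]
    linear_combination (-(colour (x, y) : A)) * this

/-! ### Interior vertices and coboundaries -/

/-- All four squares around the vertex `v` lie in `R`. -/
def IsInterior (R : Finset Cell) (v : Vertex) : Prop :=
  (v.1, v.2) ∈ R ∧ (v.1 - 1, v.2) ∈ R ∧ (v.1, v.2 - 1) ∈ R ∧ (v.1 - 1, v.2 - 1) ∈ R

/-- The function `h` vanishes off the interior vertices of `R`. -/
def VanishesOutside (R : Finset Cell) (h : Vertex → A) : Prop :=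
  ∀ v, ¬ IsInterior R v → h v = 0

/-- The circulation with height function `h`. -/
def coboundary (R : Finset Cell) (h : Vertex → A) (d : Finset Cell) : A :=
  ∑ c ∈ R, ((if d = hd c.1 c.2 then
      (colour c : A) * (h (c.1 + 1, c.2 + 1) - h (c.1 + 1, c.2)) else 0) -
    (if d = vd c.1 c.2 then (colour c : A) * (h (c.1 + 1, c.2 + 1) - h (c.1, c.2 + 1)) else 0))

lemma coboundary_eq_zero_of_not_isDomino (h : Vertex → A) {d : Finset Cell} (hdom : ¬ IsDomino d) :
    coboundary R h d = 0 := by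
  refine Finset.sum_eq_zero fun c _ => ?_
  have h1 : d ≠ hd c.1 c.2 := fun e => hdom (e ▸ isDomino_hd _ _)
  have h2 : d ≠ vd c.1 c.2 := fun e => hdom (e ▸ isDomino_vd _ _)
  rw [if_neg h1, if_neg h2, sub_zero]

/-- The edge crossed by `hd x y` has both ends at corners of the square `(x, y)`. If that square is
missing from `R`, the defining sum has no matching term and both ends are non-interior, so the
formula holds there too. -/
lemma VanishesOutside.coboundary_hd {h : Vertex → A} (hh : VanishesOutside R h) (x y : ℤ) :
    coboundary R h (hd x y) = (colour (x, y) : A) * (h (x + 1, y + 1) - h (x + 1, y)) := by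
  simp only [coboundary, hd_inj, hd_ne_vd, if_false, sub_zero]
  by_cases hc : (x, y) ∈ R
  · rw [Finset.sum_eq_single (x, y)]
    · simp
    · rintro ⟨a, b⟩ _ hne
      rw [if_neg]
      rintro ⟨rfl, rfl⟩
      exact hne rfl
    · exact fun h => absurd hc h
  · rw [Finset.sum_eq_zero, hh, hh, sub_zero, mul_zero]
    · rintro ⟨_, h2, _⟩; exact hc (by simpa using h2)
    · rintro ⟨_, _, _, h2⟩; exact hc (by simpa using h2)
    · rintro ⟨a, b⟩ hab
      rw [if_neg]
      rintro ⟨rfl, rfl⟩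
      exact hc hab

lemma VanishesOutside.coboundary_vd {h : Vertex → A} (hh : VanishesOutside R h) (x y : ℤ) :
    coboundary R h (vd x y) = -(colour (x, y) : A) * (h (x + 1, y + 1) - h (x, y + 1)) := by
  simp only [coboundary, vd_inj, vd_ne_hd, if_false, zero_sub]
  by_cases hc : (x, y) ∈ R
  · rw [Finset.sum_eq_single (x, y)]
    · simp
    · rintro ⟨a, b⟩ _ hne
      rw [if_neg, neg_zero]
      rintro ⟨rfl, rfl⟩
      exact hne rfl
    · exact fun h => absurd hc h
  · rw [Finset.sum_eq_zero, hh, hh, sub_zero, mul_zero]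
    · rintro ⟨_, _, h2, _⟩; exact hc (by simpa using h2)
    · rintro ⟨_, _, _, h2⟩; exact hc (by simpa using h2)
    · rintro ⟨a, b⟩ hab
      rw [if_neg, neg_zero]
      rintro ⟨rfl, rfl⟩
      exact hc hab

lemma VanishesOutside.isCirculation_coboundary {h : Vertex → A} (hh : VanishesOutside R h) :
    IsCirculation R (coboundary R h) := by
  constructor
  · intro d hd'
    by_cases hdom : IsDomino d
    · refine ⟨hdom, ?_⟩
      obtain ⟨x, y, rfl | rfl⟩ := isDomino_iff.1 hdom
      · rw [hh.coboundary_hd] at hd'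
        rw [hd_subset]
        by_contra hc
        apply hd'
        rw [hh, hh, sub_zero, mul_zero]
        · rintro ⟨h1, h2, h3, h4⟩; simp at h1 h2 h3 h4; tauto
        · rintro ⟨h1, h2, h3, h4⟩; simp at h1 h2 h3 h4; tauto
      · rw [hh.coboundary_vd] at hd'
        rw [vd_subset]
        by_contra hc
        apply hd'
        rw [hh, hh, sub_zero, mul_zero]
        · rintro ⟨h1, h2, h3, h4⟩; simp at h1 h2 h3 h4; tauto
        · rintro ⟨h1, h2, h3, h4⟩; simp at h1 h2 h3 h4; tauto
    · exact absurd (coboundary_eq_zero_of_not_isDomino h hdom) hd'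
  · intro x y
    unfold cellSum
    rw [hh.coboundary_hd, hh.coboundary_hd, hh.coboundary_vd, hh.coboundary_vd, colour_west,
      colour_south]
    simp only [sub_add_cancel, Int.cast_neg]
    ring

/-- A circulation is the coboundary of its potential. -/
lemma IsCirculation.coboundary_potential {z : Finset Cell → A} (hz : IsCirculation R z)
    (hv : VanishesOutside R (potential R z)) : coboundary R (potential R z) = z := by
  funext d
  by_cases hdom : IsDomino d
  · obtain ⟨x, y, rfl | rfl⟩ := isDomino_iff.1 hdom
    · rw [hv.coboundary_hd, hz.potential_north, colour_east, add_sub_cancel_right]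
      have := colour_mul_self_cast (A := A) (x, y)
      push_cast
      linear_combination z (hd x y) * this
    · rw [hv.coboundary_vd, hz.supported.potential_east, colour_north, add_sub_cancel_right]
      have := colour_mul_self_cast (A := A) (x, y)
      push_cast
      linear_combination z (vd x y) * this
  · rw [coboundary_eq_zero_of_not_isDomino _ hdom]
    by_contra h
    exact hdom (hz.supported d (Ne.symm h)).1

/-- A function vanishing off the interior is the potential of its coboundary. -/
lemma VanishesOutside.potential_coboundary {h : Vertex → A} (hh : VanishesOutside R h) :
    potential R (coboundary R h) = h := by
  funext ⟨x, y⟩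
  induction x, y using west_induction (R := R) with
  | base x y hx =>
    rw [potential_eq_zero_of_west _ hx, hh]
    rintro ⟨_, h2, _⟩
    have := hx _ h2
    dsimp at this
    omega
  | step x y ih =>
    rw [hh.isCirculation_coboundary.supported.potential_east, ih, hh.coboundary_vd, colour_south]
    have := colour_mul_self_cast (A := A) (x, y)
    simp only [sub_add_cancel, Int.cast_neg]
    linear_combination (h (x + 1, y) - h (x, y)) * this

end Circulation

/-! ### Height differences of tilings -/

/-- The difference of the height functions of two tilings, in units of `-4`, normalized to vanish
far to the west. -/
def diff (t t' : Tiling R) : Vertex → ℤ := potential R (t.ind - t'.ind)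

lemma diff_self (t : Tiling R) : diff t t = 0 := by
  funext v; simp [diff, potential]

lemma diff_add (t t' t'' : Tiling R) : diff t t' + diff t' t'' = diff t t'' := by
  unfold diff; rw [← potential_add, sub_add_sub_cancel]

lemma diff_add_apply (t t' t'' : Tiling R) (v : Vertex) :
    diff t t' v + diff t' t'' v = diff t t'' v := congrFun (diff_add t t' t'') v

lemma diff_swap (t t' : Tiling R) : diff t' t = -diff t t' := by
  rw [eq_neg_iff_add_eq_zero, diff_add, diff_self]

lemma diff_east (t t' : Tiling R) (x y : ℤ) : diff t t' (x + 1, y) =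
    diff t t' (x, y) + colour (x, y) * (t.ind (vd x (y - 1)) - t'.ind (vd x (y - 1))) := by
  simpa [diff] using (isCirculation_ind_sub t t').supported.potential_east x y

lemma diff_north (t t' : Tiling R) (x y : ℤ) : diff t t' (x, y + 1) =
    diff t t' (x, y) - colour (x, y) * (t.ind (hd (x - 1) y) - t'.ind (hd (x - 1) y)) := by
  simpa [diff] using (isCirculation_ind_sub t t').potential_north x y

/-- The heights of the two tilings agree on the boundary of `R`. -/
def SameBoundary (t t' : Tiling R) : Prop := VanishesOutside R (diff t t')

lemma SameBoundary.refl (t : Tiling R) : SameBoundary t t := fun v _ => by rw [diff_self]; rfl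

lemma SameBoundary.symm {t t' : Tiling R} (h : SameBoundary t t') : SameBoundary t' t :=
  fun v hv => by rw [diff_swap, Pi.neg_apply, h v hv, neg_zero]

lemma SameBoundary.trans {t t' t'' : Tiling R} (h : SameBoundary t t') (h' : SameBoundary t' t'') :
    SameBoundary t t'' :=
  fun v hv => by rw [← diff_add t t' t'', Pi.add_apply, h v hv, h' v hv, add_zero]

lemma SameBoundary.coboundary_diff {t t' : Tiling R} (h : SameBoundary t t') :
    coboundary R (diff t t') = t.ind - t'.ind :=
  (isCirculation_ind_sub t t').coboundary_potential h

lemma SameBoundary.eq_of_diff_eq_zero {t t' : Tiling R} (h : diff t t' = 0) : t = t' := by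
  have hs : SameBoundary t t' := fun v _ => by rw [h]; rfl
  apply Tiling.ind_injective
  rw [← sub_eq_zero, ← hs.coboundary_diff, h]
  funext d
  simp [coboundary]

/-- Admissible integer heights relative to `t₀` come from tilings. -/
lemma exists_tiling_of_height (t₀ : Tiling R) {h : Vertex → ℤ} (hh : VanishesOutside R h)
    (h01 : ∀ d, t₀.ind d + coboundary R h d = 0 ∨ t₀.ind d + coboundary R h d = 1) :
    ∃ t : Tiling R, diff t t₀ = h := by
  have hc := hh.isCirculation_coboundary
  obtain ⟨t, ht⟩ := exists_tiling_of_weight (t₀.ind + coboundary R h) h01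
    (by
      intro d hd
      by_cases h0 : t₀.ind d = 0
      · exact hc.supported d fun h' => hd (by simp [h0, h'])
      · exact t₀.isSupported_ind d h0)
    (by
      intro x y hxy
      have h1 := t₀.cellSum_ind hxy
      have h2 := hc.cellSum_eq_zero x y
      unfold cellSum at *
      simp only [Pi.add_apply]
      linarith)
  refine ⟨t, ?_⟩
  rw [diff, ht, add_sub_cancel_left, hh.potential_coboundary]

/-! ### Flips -/

/-- The flip at the 2 × 2 square with lower left unit square `c`, replacing horizontal dominoes
by vertical ones. -/
def IsFlip (c : Cell) (t t' : Tiling R) : Prop :=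
  horizontalPair c ⊆ t.dominoes ∧ verticalPair c ⊆ t'.dominoes ∧
    t.dominoes \ horizontalPair c = t'.dominoes \ verticalPair c

lemma horizontalPair_eq (a b : ℤ) : horizontalPair (a, b) = {hd a b, hd a (b + 1)} := by
  simp [horizontalPair, hd]

lemma verticalPair_eq (a b : ℤ) : verticalPair (a, b) = {vd a b, vd (a + 1) b} := by
  simp [verticalPair, vd]

lemma vanishesOutside_single {A : Type*} [CommRing A] {v : Vertex} (hv : IsInterior R v) (k : A) :
    VanishesOutside R (Pi.single v k : Vertex → A) := by
  intro w hw
  rw [Pi.single_eq_of_ne]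
  rintro rfl
  exact hw hv

lemma isInterior_add_one {a b : ℤ} : IsInterior R (a + 1, b + 1) ↔
    (a, b) ∈ R ∧ (a + 1, b) ∈ R ∧ (a, b + 1) ∈ R ∧ (a + 1, b + 1) ∈ R := by
  simp only [IsInterior, add_sub_cancel_right]
  tauto

lemma IsFlip.isInterior {a b : ℤ} {t t' : Tiling R} (h : IsFlip (a, b) t t') :
    IsInterior R (a + 1, b + 1) := by
  have h1 := h.1
  rw [horizontalPair_eq, Finset.insert_subset_iff, Finset.singleton_subset_iff] at h1
  have h2 := hd_subset.1 (t.subset _ h1.1)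
  have h3 := hd_subset.1 (t.subset _ h1.2)
  exact isInterior_add_one.2 ⟨h2.1, h2.2, h3.1, h3.2⟩

lemma IsFlip.ind {a b : ℤ} {t t' : Tiling R} (h : IsFlip (a, b) t t') (d : Finset Cell) :
    t'.ind d = t.ind d + (if d = vd a b ∨ d = vd (a + 1) b then 1 else 0)
      - (if d = hd a b ∨ d = hd a (b + 1) then 1 else 0) := by
  obtain ⟨h1, h2, h3⟩ := h
  rw [horizontalPair_eq] at h1 h3
  rw [verticalPair_eq] at h2 h3
  simp only [Finset.insert_subset_iff, Finset.singleton_subset_iff] at h1 h2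
  have h4 := Finset.ext_iff.1 h3 d
  simp only [Finset.mem_sdiff, Finset.mem_insert, Finset.mem_singleton] at h4
  have hv : (d = vd a b ∨ d = vd (a + 1) b) → d ∈ t'.dominoes ∧ d ∉ t.dominoes := by
    rintro (rfl | rfl)
    · exact ⟨h2.1, fun h' => vd_ne_hd
        (t.eq_of_mem h' h1.1 (mem_vd.2 (Or.inl rfl)) (mem_hd.2 (Or.inl rfl)))⟩
    · exact ⟨h2.2, fun h' => vd_ne_hd
        (t.eq_of_mem h' h1.1 (mem_vd.2 (Or.inl rfl)) (mem_hd.2 (Or.inr rfl)))⟩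
  have hh : (d = hd a b ∨ d = hd a (b + 1)) → d ∈ t.dominoes ∧ d ∉ t'.dominoes := by
    rintro (rfl | rfl)
    · exact ⟨h1.1, fun h' => hd_ne_vd
        (t'.eq_of_mem h' h2.1 (mem_hd.2 (Or.inl rfl)) (mem_vd.2 (Or.inl rfl)))⟩
    · exact ⟨h1.2, fun h' => hd_ne_vd
        (t'.eq_of_mem h' h2.1 (mem_hd.2 (Or.inl rfl)) (mem_vd.2 (Or.inr rfl)))⟩
  unfold Tiling.ind
  by_cases e1 : d = vd a b ∨ d = vd (a + 1) b
  · have e2 : ¬ (d = hd a b ∨ d = hd a (b + 1)) := fun e2 => (hv e1).2 (hh e2).1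
    simp [e1, e2, hv e1]
  · by_cases e2 : d = hd a b ∨ d = hd a (b + 1)
    · simp [e1, e2, hh e2]
    · simp only [e1, e2, not_false_eq_true, and_true] at h4
      simp [e1, e2, h4]

/-- A step at one vertex affects only the four dominoes crossing the edges there. The factor `k`
serves both directions of a flip: 1 puts in the vertical pair, -1 the horizontal pair. -/
lemma coboundary_single {a b : ℤ} (hv : IsInterior R (a + 1, b + 1)) (k : ℤ) (d : Finset Cell) :
    coboundary R (Pi.single (a + 1, b + 1) (-colour (a, b) * k) : Vertex → ℤ) d =
      (if d = vd a b ∨ d = vd (a + 1) b then k else 0)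
      - (if d = hd a b ∨ d = hd a (b + 1) then k else 0) := by
  have hs := vanishesOutside_single hv (-colour (a, b) * k)
  have hcol := colour_mul_self (a, b)
  by_cases hdom : IsDomino d
  · obtain ⟨x, y, rfl | rfl⟩ := isDomino_iff.1 hdom
    · rw [hs.coboundary_hd]
      simp only [hd_ne_vd, or_self, if_false, zero_sub, hd_inj, Pi.single_apply, Prod.mk.injEq,
        add_left_inj, Int.cast_id]
      by_cases hx : x = a
      · subst hx
        by_cases hy : y = b
        · subst hy
          simp
          linear_combination k * hcol
        · by_cases hy' : y = b + 1
          · subst hy'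
            simp [colour_north]
            linear_combination k * hcol
          · simp [hy, hy']
      · simp [hx]
    · rw [hs.coboundary_vd]
      simp only [vd_ne_hd, or_self, if_false, sub_zero, vd_inj, Pi.single_apply, Prod.mk.injEq,
        add_left_inj, Int.cast_id]
      by_cases hy : y = b
      · subst hy
        by_cases hx : x = a
        · subst hx
          simp
          linear_combination k * hcol
        · by_cases hx' : x = a + 1
          · subst hx'
            simp [colour_east]
            linear_combination k * hcol
          · simp [hx, hx']
      · simp [hy]
  · rw [coboundary_eq_zero_of_not_isDomino _ hdom, if_neg, if_neg, sub_zero]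
    · rintro (rfl | rfl) <;> exact hdom (isDomino_hd _ _)
    · rintro (rfl | rfl) <;> exact hdom (isDomino_vd _ _)

/-- Translates the combinatorial flip into heights: only the centre of the 2 × 2 square moves.
Conversely a jump of one at that vertex forces the indicators on the four dominoes inside the
square, since they take only the values 0 and 1. -/
lemma isFlip_iff {a b : ℤ} {t t' : Tiling R} : IsFlip (a, b) t t' ↔
    IsInterior R (a + 1, b + 1) ∧ diff t' t = Pi.single (a + 1, b + 1) (-colour (a, b)) := by
  constructor
  · intro h
    refine ⟨h.isInterior, ?_⟩
    have : t'.ind - t.ind =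
        coboundary R (Pi.single (a + 1, b + 1) (-colour (a, b) * 1) : Vertex → ℤ) := by
      funext d
      rw [coboundary_single h.isInterior, Pi.sub_apply, h.ind]
      ring
    rw [diff, this, (vanishesOutside_single h.isInterior _).potential_coboundary, mul_one]
  · rintro ⟨hv, h⟩
    have hs : SameBoundary t' t := by
      rw [SameBoundary, h]
      exact vanishesOutside_single hv _
    have key : ∀ d, t'.ind d - t.ind d = (if d = vd a b ∨ d = vd (a + 1) b then 1 else 0)
        - (if d = hd a b ∨ d = hd a (b + 1) then 1 else 0) := by
      intro d
      rw [← coboundary_single hv, mul_one, ← h, hs.coboundary_diff, Pi.sub_apply]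
    have hH : ∀ d, (d = hd a b ∨ d = hd a (b + 1)) → t.ind d = 1 ∧ t'.ind d = 0 := by
      intro d hd'
      have := key d
      have hn : ¬ (d = vd a b ∨ d = vd (a + 1) b) := by
        rcases hd' with rfl | rfl <;> simp [hd_ne_vd]
      rw [if_neg hn, if_pos hd'] at this
      rcases t.ind_eq_or d with h1 | h1 <;> rcases t'.ind_eq_or d with h2 | h2 <;> omega
    have hV : ∀ d, (d = vd a b ∨ d = vd (a + 1) b) → t.ind d = 0 ∧ t'.ind d = 1 := by
      intro d hd'
      have := key d
      have hn : ¬ (d = hd a b ∨ d = hd a (b + 1)) := by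
        rcases hd' with rfl | rfl <;> simp [vd_ne_hd]
      rw [if_pos hd', if_neg hn] at this
      rcases t.ind_eq_or d with h1 | h1 <;> rcases t'.ind_eq_or d with h2 | h2 <;> omega
    refine ⟨?_, ?_, ?_⟩
    · intro d hd'
      rw [horizontalPair_eq] at hd'
      exact Tiling.ind_eq_one.1 (hH d (by simpa using hd')).1
    · intro d hd'
      rw [verticalPair_eq] at hd'
      exact Tiling.ind_eq_one.1 (hV d (by simpa using hd')).2
    · ext d
      simp only [horizontalPair_eq, verticalPair_eq, Finset.mem_sdiff, Finset.mem_insert,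
        Finset.mem_singleton, ← Tiling.ind_eq_one]
      have := key d
      have h1 := hH d
      have h2 := hV d
      by_cases e1 : d = vd a b ∨ d = vd (a + 1) b
      · simp [e1, h2 e1]
      · by_cases e2 : d = hd a b ∨ d = hd a (b + 1)
        · simp [e2, h1 e2]
        · simp only [e1, e2, if_false, sub_zero] at this
          simp only [e1, e2, not_false_eq_true, and_true]
          constructor <;> intro <;> omega

lemma flipGraph_adj_iff {t t' : Tiling R} : (flipGraph R).Adj t t' ↔
    ∃ v, IsInterior R v ∧ (diff t' t = Pi.single v 1 ∨ diff t' t = Pi.single v (-1)) := by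
  have hrel : (flipGraph R).Adj t t' ↔ t ≠ t' ∧ ((∃ c, IsFlip c t t') ∨ ∃ c, IsFlip c t' t) :=
    SimpleGraph.fromRel_adj _ _ _
  rw [hrel]
  constructor
  · rintro ⟨_, ⟨⟨a, b⟩, h⟩ | ⟨⟨a, b⟩, h⟩⟩
    · obtain ⟨h1, h2⟩ := isFlip_iff.1 h
      refine ⟨_, h1, ?_⟩
      rcases colour_eq_or (a, b) with hc | hc <;> rw [h2, hc] <;> simp
    · obtain ⟨h1, h2⟩ := isFlip_iff.1 h
      refine ⟨_, h1, ?_⟩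
      rw [diff_swap, h2, ← Pi.single_neg]
      rcases colour_eq_or (a, b) with hc | hc <;> rw [hc] <;> simp
  · rintro ⟨⟨x, y⟩, h1, h2⟩
    obtain ⟨a, rfl⟩ : ∃ a, x = a + 1 := ⟨x - 1, by ring⟩
    obtain ⟨b, rfl⟩ : ∃ b, y = b + 1 := ⟨y - 1, by ring⟩
    refine ⟨?_, ?_⟩
    · rintro rfl
      rw [diff_self] at h2
      rcases h2 with h2 | h2 <;> simpa using congrFun h2 (a + 1, b + 1)
    -- The colour of the lower left square decides whether the given sign replaces horizontal
    -- dominoes by vertical ones or the reverse.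
    · by_cases hc : diff t' t = Pi.single (a + 1, b + 1) (-colour (a, b))
      · exact Or.inl ⟨_, isFlip_iff.2 ⟨h1, hc⟩⟩
      · refine Or.inr ⟨_, isFlip_iff.2 ⟨h1, ?_⟩⟩
        rw [diff_swap]
        rcases h2 with h2 | h2 <;> rcases colour_eq_or (a, b) with h3 | h3 <;>
          simp_all [Pi.single_neg]

lemma SameBoundary.of_reachable {t t' : Tiling R} (h : (flipGraph R).Reachable t t') :
    SameBoundary t t' := by
  obtain ⟨p⟩ := h
  induction p with
  | nil => exact SameBoundary.refl _
  | cons hadj _ ih =>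
    refine SameBoundary.trans ?_ ih
    obtain ⟨v, hv, h | h⟩ := flipGraph_adj_iff.1 hadj <;> apply SameBoundary.symm <;>
      rw [SameBoundary, h] <;> exact vanishesOutside_single hv _

/-! ### Connecting tilings by flips -/

/-- The flipped tiling is obtained from its height function, so that only 0-1 weights have to be
checked. -/
lemma exists_flip_of_horizontal (t : Tiling R) {a b : ℤ} (h1 : t.ind (hd a b) = 1)
    (h2 : t.ind (hd a (b + 1)) = 1) :
    ∃ s : Tiling R, diff s t = Pi.single (a + 1, b + 1) (-colour (a, b)) := by
  rw [Tiling.ind_eq_one] at h1 h2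
  have hv : IsInterior R (a + 1, b + 1) := by
    have h3 := hd_subset.1 (t.subset _ h1)
    have h4 := hd_subset.1 (t.subset _ h2)
    exact isInterior_add_one.2 ⟨h3.1, h3.2, h4.1, h4.2⟩
  have h3 : t.ind (vd a b) = 0 := Tiling.ind_eq_zero.2 fun h' =>
    vd_ne_hd (t.eq_of_mem h' h1 (mem_vd.2 (Or.inl rfl)) (mem_hd.2 (Or.inl rfl)))
  have h4 : t.ind (vd (a + 1) b) = 0 := Tiling.ind_eq_zero.2 fun h' =>
    vd_ne_hd (t.eq_of_mem h' h1 (mem_vd.2 (Or.inl rfl)) (mem_hd.2 (Or.inr rfl)))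
  rw [← Tiling.ind_eq_one] at h1 h2
  have hvan := vanishesOutside_single hv (-colour (a, b) * 1)
  obtain ⟨s, hs⟩ := exists_tiling_of_height t hvan (by
    intro d
    rw [coboundary_single hv]
    by_cases e1 : d = vd a b ∨ d = vd (a + 1) b
    · rcases e1 with rfl | rfl <;> simp [vd_ne_hd, h3, h4]
    · by_cases e2 : d = hd a b ∨ d = hd a (b + 1)
      · rcases e2 with rfl | rfl <;> simp [hd_ne_vd, h1, h2]
      · simpa [e1, e2] using t.ind_eq_or d)
  exact ⟨s, by rw [hs, mul_one]⟩

lemma exists_flip_of_vertical (t : Tiling R) {a b : ℤ} (h1 : t.ind (vd a b) = 1)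
    (h2 : t.ind (vd (a + 1) b) = 1) :
    ∃ s : Tiling R, diff s t = Pi.single (a + 1, b + 1) (colour (a, b)) := by
  rw [Tiling.ind_eq_one] at h1 h2
  have hv : IsInterior R (a + 1, b + 1) := by
    have h3 := vd_subset.1 (t.subset _ h1)
    have h4 := vd_subset.1 (t.subset _ h2)
    exact isInterior_add_one.2 ⟨h3.1, h4.1, h3.2, h4.2⟩
  have h3 : t.ind (hd a b) = 0 := Tiling.ind_eq_zero.2 fun h' =>
    hd_ne_vd (t.eq_of_mem h' h1 (mem_hd.2 (Or.inl rfl)) (mem_vd.2 (Or.inl rfl)))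
  have h4 : t.ind (hd a (b + 1)) = 0 := Tiling.ind_eq_zero.2 fun h' =>
    hd_ne_vd (t.eq_of_mem h' h1 (mem_hd.2 (Or.inl rfl)) (mem_vd.2 (Or.inr rfl)))
  rw [← Tiling.ind_eq_one] at h1 h2
  have hvan := vanishesOutside_single hv (-colour (a, b) * (-1))
  obtain ⟨s, hs⟩ := exists_tiling_of_height t hvan (by
    intro d
    rw [coboundary_single hv]
    by_cases e1 : d = vd a b ∨ d = vd (a + 1) b
    · rcases e1 with rfl | rfl <;> simp [vd_ne_hd, h1, h2]
    · by_cases e2 : d = hd a b ∨ d = hd a (b + 1)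
      · rcases e2 with rfl | rfl <;> simp [hd_ne_vd, h3, h4]
      · simpa [e1, e2] using t.ind_eq_or d)
  exact ⟨s, by rw [hs, mul_neg_one, neg_neg]⟩

/-! ### Level sets of the height difference -/

/-- The vertex `v` has both a horizontal and a vertical neighbour in `F` along edges not crossed
by `t`. -/
def Linked (t : Tiling R) (F : Finset Vertex) (v : Vertex) : Prop :=
  ((v.1 + 1, v.2) ∈ F ∧ t.ind (vd v.1 (v.2 - 1)) = 0 ∨
    (v.1 - 1, v.2) ∈ F ∧ t.ind (vd (v.1 - 1) (v.2 - 1)) = 0) ∧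
  ((v.1, v.2 + 1) ∈ F ∧ t.ind (hd (v.1 - 1) v.2) = 0 ∨
    (v.1, v.2 - 1) ∈ F ∧ t.ind (hd (v.1 - 1) (v.2 - 1)) = 0)

lemma sum_insert_le {ι : Type*} [DecidableEq ι] (f : ι → ℚ) (hf : ∀ i, 0 ≤ f i) (a : ι)
    (s : Finset ι) : ∑ i ∈ insert a s, f i ≤ f a + ∑ i ∈ s, f i := by
  by_cases h : a ∈ s
  · rw [Finset.insert_eq_of_mem h]
    linarith [hf a]
  · rw [Finset.sum_insert h]

/-- In a nonempty linked set inside a level set of the height difference, an extremal vertex can be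
pushed across a domino common to both tilings. -/
lemma exists_linked_lt {t t' : Tiling R} (hs : SameBoundary t t') {M : ℤ} (hM : M ≠ 0)
    {F : Finset Vertex} (hF : F.Nonempty) (hFM : ∀ v ∈ F, diff t t' v = M)
    (hL : ∀ v ∈ F, Linked t F v) :
    ∃ F' : Finset Vertex, F'.Nonempty ∧ (∀ v ∈ F', diff t t' v = M) ∧ (∀ v ∈ F', Linked t F' v) ∧
      ∑ v ∈ F', (2 : ℚ) ^ (2 * v.1 + v.2) < ∑ v ∈ F, (2 : ℚ) ^ (2 * v.1 + v.2) := by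
  have hint : ∀ v ∈ F, IsInterior R v := by
    intro v hv
    by_contra h
    exact hM ((hFM v hv).symm.trans (hs v h))
  -- The functional 2x + y is larger at the east, north and also south-east neighbours of a vertex.
  -- So the extremal vertex is linked to the west and the south, and its south neighbour is linked
  -- to the west.
  obtain ⟨⟨x, y⟩, hv, hmax⟩ := F.exists_max_image (fun v => 2 * v.1 + v.2) hF
  have hout : ∀ p q : ℤ, 2 * x + y < 2 * p + q → (p, q) ∉ F := by
    intro p q h h'
    have := hmax _ h'
    dsimp at this
    omega
  obtain ⟨hw, n1⟩ : (x - 1, y) ∈ F ∧ t.ind (vd (x - 1) (y - 1)) = 0 := by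
    rcases (hL _ hv).1 with h | h
    · exact absurd h.1 (hout _ _ (by dsimp; omega))
    · exact h
  obtain ⟨hso, e1⟩ : (x, y - 1) ∈ F ∧ t.ind (hd (x - 1) (y - 1)) = 0 := by
    rcases (hL _ hv).2 with h | h
    · exact absurd h.1 (hout _ _ (by dsimp; omega))
    · exact h
  obtain ⟨hsw, s1⟩ : (x - 1, y - 1) ∈ F ∧ t.ind (vd (x - 1) (y - 1 - 1)) = 0 := by
    rcases (hL _ hso).1 with h | h
    · exact absurd h.1 (hout _ _ (by dsimp; omega))
    · exact h
  -- Three sides of the square `(x - 1, y - 1)` are uncrossed, so its domino in `t` crosses the west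
  -- side. Both ends of that side are at height `M`, so `t'` contains the same domino.
  have c1 := t.cellSum_ind (hint _ hv).2.2.2
  simp only [cellSum, n1, e1, s1, zero_add, add_zero] at c1
  have c1' : t'.ind (hd (x - 1 - 1) (y - 1)) = 1 := by
    have h := diff_north t t' (x - 1) (y - 1)
    rw [sub_add_cancel, hFM _ hw, hFM _ hsw, c1] at h
    have h0 : colour (x - 1, y - 1) * (1 - t'.ind (hd (x - 1 - 1) (y - 1))) = 0 := by linarith
    rcases mul_eq_zero.1 h0 with h0 | h0
    · rcases colour_eq_or (x - 1, y - 1) with h | h <;> omega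
    · omega
  -- The common domino also covers the next square to the west, whose other three sides are then
  -- uncrossed by both tilings. The level `M` thus extends to its two western corners.
  have around : ∀ s : Tiling R, s.ind (hd (x - 1 - 1) (y - 1)) = 1 →
      s.ind (hd (x - 1 - 1 - 1) (y - 1)) = 0 ∧ s.ind (vd (x - 1 - 1) (y - 1)) = 0 ∧
        s.ind (vd (x - 1 - 1) (y - 1 - 1)) = 0 := by
    intro s h
    have hc := (hd_subset.1 (s.subset _ (Tiling.ind_eq_one.1 h))).1
    have := s.cellSum_ind hc
    unfold cellSum at this
    rcases s.ind_eq_or (hd (x - 1 - 1 - 1) (y - 1)) with h1 | h1 <;>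
    rcases s.ind_eq_or (vd (x - 1 - 1) (y - 1)) with h2 | h2 <;>
    rcases s.ind_eq_or (vd (x - 1 - 1) (y - 1 - 1)) with h3 | h3 <;> omega
  obtain ⟨w2, n2, s2⟩ := around t c1
  obtain ⟨w2', n2', s2'⟩ := around t' c1'
  have ha : diff t t' (x - 1 - 1, y) = M := by
    have h := diff_east t t' (x - 1 - 1) y
    rw [sub_add_cancel, hFM _ hw, n2, n2'] at h
    simpa using h.symm
  have hb : diff t t' (x - 1 - 1, y - 1) = M := by
    have h := diff_east t t' (x - 1 - 1) (y - 1)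
    rw [sub_add_cancel, hFM _ hsw, s2, s2'] at h
    simpa using h.symm
  -- the south neighbour of the extremal vertex stays if its own south neighbour needs it
  obtain ⟨G, hGF, hvG, hGF', hkeep, hdrop⟩ : ∃ G : Finset Vertex, G ⊆ F ∧ (x, y) ∉ G ∧
      (∀ u ∈ F, u ≠ (x, y) → u ≠ (x, y - 1) → u ∈ G) ∧
      (((x, y - 1) ∈ G) → (x, y - 1 - 1) ∈ F ∧ t.ind (hd (x - 1) (y - 1 - 1)) = 0) ∧
      ((x, y - 1 - 1) ∈ F → t.ind (hd (x - 1) (y - 1 - 1)) = 0 → (x, y - 1) ∈ G) := by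
    by_cases hk : (x, y - 1 - 1) ∈ F ∧ t.ind (hd (x - 1) (y - 1 - 1)) = 0
    · refine ⟨F.erase (x, y), F.erase_subset _, F.notMem_erase _, ?_, fun _ => hk, fun _ _ => ?_⟩
      · exact fun u hu h1 _ => Finset.mem_erase.2 ⟨h1, hu⟩
      · exact Finset.mem_erase.2 ⟨by simp, hso⟩
    · refine ⟨(F.erase (x, y)).erase (x, y - 1), (Finset.erase_subset _ _).trans
        (F.erase_subset _), by simp, ?_, ?_, fun h1 h2 => absurd ⟨h1, h2⟩ hk⟩
      · exact fun u hu h1 h2 => Finset.mem_erase.2 ⟨h2, Finset.mem_erase.2 ⟨h1, hu⟩⟩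
      · exact fun h => absurd h (Finset.notMem_erase _ _)
  have hneG : ∀ p q, (p, q) ∈ F → p ≠ x → (p, q) ∈ G := by
    intro p q h h'
    refine hGF' _ h ?_ ?_ <;> simp [h']
  have hG' : ∀ u ∈ G, u ∈ insert (x - 1 - 1, y) (insert (x - 1 - 1, y - 1) G) := fun u hu => by
    simp [hu]
  -- The two new vertices are linked to each other vertically and to `(x - 1, y)` and `(x - 1, y -
  -- 1)` horizontally; the latter two may lose their eastern links and gain western ones.
  refine ⟨insert (x - 1 - 1, y) (insert (x - 1 - 1, y - 1) G), Finset.insert_nonempty _ _,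
    ?_, ?_, ?_⟩
  · intro u hu
    simp only [Finset.mem_insert] at hu
    rcases hu with rfl | rfl | hu
    · exact ha
    · exact hb
    · exact hFM u (hGF hu)
  · intro u hu
    simp only [Finset.mem_insert] at hu
    rcases hu with rfl | rfl | hu
    · refine ⟨Or.inl ⟨hG' _ ?_, n2⟩, Or.inr ⟨?_, w2⟩⟩
      · dsimp only
        rw [sub_add_cancel]
        exact hneG _ _ hw (by omega)
      · simp
    · refine ⟨Or.inl ⟨hG' _ ?_, s2⟩, Or.inl ⟨?_, w2⟩⟩
      · dsimp only
        rw [sub_add_cancel]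
        exact hneG _ _ hsw (by omega)
      · simp
    · obtain ⟨p, q⟩ := u
      have huF := hGF hu
      have hne : ¬ (p = x ∧ q = y) := by
        rintro ⟨rfl, rfl⟩
        exact hvG hu
      obtain ⟨hh, hv'⟩ := hL _ huF
      dsimp only at hh hv'
      constructor
      · dsimp only
        rcases hh with ⟨h1, h2⟩ | ⟨h1, h2⟩
        · by_cases hp : p + 1 = x
          · obtain rfl : p = x - 1 := by omega
            have hq : q = y ∨ q = y - 1 ∨ (q ≠ y ∧ q ≠ y - 1) := by omega
            rcases hq with rfl | rfl | ⟨hq1, hq2⟩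
            · exact Or.inr ⟨by simp, n2⟩
            · exact Or.inr ⟨by simp, s2⟩
            · exact Or.inl ⟨hG' _ (hGF' _ h1 (by simp [hq1]) (by simp [hq2])), h2⟩
          · exact Or.inl ⟨hG' _ (hneG _ _ h1 hp), h2⟩
        · refine Or.inr ⟨hG' _ (hGF' _ h1 ?_ ?_), h2⟩
          · rintro h
            simp only [Prod.mk.injEq] at h
            exact hout p q (by omega) huF
          · rintro h
            simp only [Prod.mk.injEq] at h
            exact hout p q (by omega) huF
      · dsimp only
        by_cases hp : p = x
        · subst hp
          by_cases hq : q = y - 1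
          · subst hq
            obtain ⟨k1, k2⟩ := hkeep hu
            exact Or.inr ⟨hG' _ (hGF' _ k1 (by simp; omega) (by simp)), k2⟩
          · rcases hv' with ⟨h1, h2⟩ | ⟨h1, h2⟩
            · by_cases hq' : q = y - 1 - 1
              · subst hq'
                refine Or.inl ⟨hG' _ ?_, h2⟩
                rw [sub_add_cancel]
                exact hdrop huF h2
              · exact Or.inl ⟨hG' _ (hGF' _ h1 (by simp; omega) (by simp; omega)), h2⟩
            · refine Or.inr ⟨hG' _ (hGF' _ h1 ?_ (by simp; omega)), h2⟩
              rintro h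
              simp only [Prod.mk.injEq] at h
              exact hout p q (by omega) huF
        · rcases hv' with ⟨h1, h2⟩ | ⟨h1, h2⟩
          · exact Or.inl ⟨hG' _ (hneG _ _ h1 hp), h2⟩
          · exact Or.inr ⟨hG' _ (hneG _ _ h1 hp), h2⟩
  -- Relative to the removed vertex `(x, y)` the added ones weigh 1/16 and 1/32, together less than
  -- 1.
  · have hpos : ∀ v : Vertex, (0 : ℚ) < 2 ^ (2 * v.1 + v.2) := fun v => by positivity
    have h1 := sum_insert_le (fun v : Vertex => (2 : ℚ) ^ (2 * v.1 + v.2)) (fun v => (hpos v).le)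
      (x - 1 - 1, y) (insert (x - 1 - 1, y - 1) G)
    have h2 := sum_insert_le (fun v : Vertex => (2 : ℚ) ^ (2 * v.1 + v.2)) (fun v => (hpos v).le)
      (x - 1 - 1, y - 1) G
    have h3 : ∑ v ∈ G, (2 : ℚ) ^ (2 * v.1 + v.2) ≤ ∑ v ∈ F.erase (x, y), (2 : ℚ) ^ (2 * v.1 + v.2) :=
      Finset.sum_le_sum_of_subset_of_nonneg
        (fun u hu => Finset.mem_erase.2 ⟨fun h => hvG (h ▸ hu), hGF hu⟩)
        fun v _ _ => (hpos v).le
    have h4 := Finset.sum_erase_add F (fun v : Vertex => (2 : ℚ) ^ (2 * v.1 + v.2)) hv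
    dsimp only at h1 h2 h4
    have p1 : (2 : ℚ) ^ (2 * (x - 1 - 1) + y) = 2 ^ (2 * x + y) / 16 := by
      rw [show 2 * (x - 1 - 1) + y = 2 * x + y - 4 by ring, zpow_sub₀ (by norm_num)]
      norm_num
    have p2 : (2 : ℚ) ^ (2 * (x - 1 - 1) + (y - 1)) = 2 ^ (2 * x + y) / 32 := by
      rw [show 2 * (x - 1 - 1) + (y - 1) = 2 * x + y - 5 by ring, zpow_sub₀ (by norm_num)]
      norm_num
    have := hpos (x, y)
    dsimp only at this
    linarith

/-- A level set of the height difference contains no nonempty linked set. -/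
lemma not_linked {t t' : Tiling R} (hs : SameBoundary t t') {M : ℤ} (hM : M ≠ 0)
    {F : Finset Vertex} (hF : F.Nonempty) (hFM : ∀ v ∈ F, diff t t' v = M)
    (hL : ∀ v ∈ F, Linked t F v) : False := by
  classical
  -- A square is named by its lower left corner, so `R`, read as a set of vertices, contains every
  -- interior vertex. Linked sets at height `M` are therefore finitely many, and one has least
  -- weight.
  have hsub : ∀ F : Finset Vertex, (∀ v ∈ F, diff t t' v = M) → F ⊆ R := by
    intro F hF v hv
    by_contra h
    exact hM ((hF v hv).symm.trans (hs v fun h' => h h'.1))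
  obtain ⟨F₀, h₀, hmin⟩ := (R.powerset.filter fun F : Finset Vertex => F.Nonempty ∧
    (∀ v ∈ F, diff t t' v = M) ∧ ∀ v ∈ F, Linked t F v).exists_min_image
      (fun F => ∑ v ∈ F, (2 : ℚ) ^ (2 * v.1 + v.2))
      ⟨F, Finset.mem_filter.2 ⟨Finset.mem_powerset.2 (hsub F hFM), hF, hFM, hL⟩⟩
  obtain ⟨_, h1, h2, h3⟩ := Finset.mem_filter.1 h₀
  obtain ⟨F', k1, k2, k3, k4⟩ := exists_linked_lt hs hM h1 h2 h3
  have := hmin F' (Finset.mem_filter.2 ⟨Finset.mem_powerset.2 (hsub F' k2), k1, k2, k3⟩)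
  linarith

/-- At some vertex where the height difference is maximal, one of the two tilings admits a flip
that decreases it. -/
lemma exists_flip_at_max {t t' : Tiling R} (hs : SameBoundary t t') {M : ℤ} (hM : 0 < M)
    (hle : ∀ v, diff t t' v ≤ M) {v₀ : Vertex} (hv₀ : diff t t' v₀ = M) :
    ∃ v, diff t t' v = M ∧ ((∃ s : Tiling R, diff s t = Pi.single v (-1)) ∨
      ∃ s : Tiling R, diff s t' = Pi.single v 1) := by
  by_contra hcon
  have hint : ∀ v, diff t t' v = M → IsInterior R v := by
    intro v hv
    by_contra h
    exact hM.ne' (hv.symm.trans (hs v h))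
  have hmem : ∀ v, v ∈ R.filter (fun v => diff t t' v = M) ↔ diff t t' v = M := by
    intro v
    rw [Finset.mem_filter, and_iff_right_iff_imp]
    exact fun h => (hint v h).1
  -- Without a flip of the required kind, the whole maximal level set is linked.
  refine not_linked hs hM.ne' (F := R.filter fun v => diff t t' v = M)
    ⟨v₀, (hmem _).2 hv₀⟩ (fun v hv => (hmem v).1 hv) ?_
  intro v hv
  rw [hmem] at hv
  have hn1 : ∀ s : Tiling R, diff s t ≠ Pi.single v (-1) :=
    fun s h => hcon ⟨v, hv, Or.inl ⟨s, h⟩⟩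
  have hn2 : ∀ s : Tiling R, diff s t' ≠ Pi.single v 1 := fun s h => hcon ⟨v, hv, Or.inr ⟨s, h⟩⟩
  obtain ⟨x, y⟩ := v
  unfold Linked
  simp only [hmem]
  have dE := diff_east t t' x y
  have dW := diff_east t t' (x - 1) y
  have dN := diff_north t t' x y
  have dS := diff_north t t' x (y - 1)
  have lE := hle (x + 1, y)
  have lW := hle (x - 1, y)
  have lN := hle (x, y + 1)
  have lS := hle (x, y - 1)
  rw [sub_add_cancel] at dW dS
  rw [colour_west] at dW
  rw [colour_south] at dS
  have hcol : colour (x - 1, y - 1) = colour (x, y) := by rw [colour_south, colour_west, neg_neg]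
  have H : ∀ s : Tiling R, s.ind (hd (x - 1) (y - 1)) = 1 → s.ind (hd (x - 1) y) = 1 →
      ∃ s' : Tiling R, diff s' s = Pi.single (x, y) (-colour (x, y)) := by
    intro s h1 h2
    have := exists_flip_of_horizontal s h1 (by rwa [sub_add_cancel])
    rwa [sub_add_cancel, sub_add_cancel, hcol] at this
  have V : ∀ s : Tiling R, s.ind (vd (x - 1) (y - 1)) = 1 → s.ind (vd x (y - 1)) = 1 →
      ∃ s' : Tiling R, diff s' s = Pi.single (x, y) (colour (x, y)) := by
    intro s h1 h2
    have := exists_flip_of_vertical s h1 (by rwa [sub_add_cancel])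
    rwa [sub_add_cancel, sub_add_cancel, hcol] at this
  rw [hv] at dE dW dN dS
  have iE := t.ind_eq_or (vd x (y - 1))
  have iW := t.ind_eq_or (vd (x - 1) (y - 1))
  have iN := t.ind_eq_or (hd (x - 1) y)
  have iS := t.ind_eq_or (hd (x - 1) (y - 1))
  have iE' := t'.ind_eq_or (vd x (y - 1))
  have iW' := t'.ind_eq_or (vd (x - 1) (y - 1))
  have iN' := t'.ind_eq_or (hd (x - 1) y)
  have iS' := t'.ind_eq_or (hd (x - 1) (y - 1))
  generalize diff t t' (x + 1, y) = aE at *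
  generalize diff t t' (x - 1, y) = aW at *
  generalize diff t t' (x, y + 1) = aN at *
  generalize diff t t' (x, y - 1) = aS at *
  -- Maximality orders the two indicators on each edge at the vertex. In the black case `t ≤ t'` on
  -- horizontal edges and `t ≥ t'` on vertical ones. The missing flips leave a horizontal edge
  -- uncrossed by `t'` and a vertical one uncrossed by `t`; each is then uncrossed by both tilings,
  -- and its other end is again at height `M`. In the white case the tilings exchange roles.
  rcases colour_eq_or (x, y) with hc | hc
  · rw [hc] at dE dW dN dS H V
    have h1 : ¬ (t.ind (hd (x - 1) (y - 1)) = 1 ∧ t.ind (hd (x - 1) y) = 1) := fun h => by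
      obtain ⟨s, hs'⟩ := H t h.1 h.2
      exact hn1 s hs'
    have h2 : ¬ (t'.ind (vd (x - 1) (y - 1)) = 1 ∧ t'.ind (vd x (y - 1)) = 1) := fun h => by
      obtain ⟨s, hs'⟩ := V t' h.1 h.2
      exact hn2 s hs'
    clear H V hn1 hn2 hcon hint hmem hle hs
    generalize t.ind (vd x (y - 1)) = bE at *
    generalize t.ind (vd (x - 1) (y - 1)) = bW at *
    generalize t.ind (hd (x - 1) y) = bN at *
    generalize t.ind (hd (x - 1) (y - 1)) = bS at *
    generalize t'.ind (vd x (y - 1)) = cE at *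
    generalize t'.ind (vd (x - 1) (y - 1)) = cW at *
    generalize t'.ind (hd (x - 1) y) = cN at *
    generalize t'.ind (hd (x - 1) (y - 1)) = cS at *
    constructor <;> omega
  · rw [hc] at dE dW dN dS H V
    have h1 : ¬ (t.ind (vd (x - 1) (y - 1)) = 1 ∧ t.ind (vd x (y - 1)) = 1) := fun h => by
      obtain ⟨s, hs'⟩ := V t h.1 h.2
      exact hn1 s hs'
    have h2 : ¬ (t'.ind (hd (x - 1) (y - 1)) = 1 ∧ t'.ind (hd (x - 1) y) = 1) := fun h => by
      obtain ⟨s, hs'⟩ := H t' h.1 h.2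
      exact hn2 s (by simpa using hs')
    clear H V hn1 hn2 hcon hint hmem hle hs
    generalize t.ind (vd x (y - 1)) = bE at *
    generalize t.ind (vd (x - 1) (y - 1)) = bW at *
    generalize t.ind (hd (x - 1) y) = bN at *
    generalize t.ind (hd (x - 1) (y - 1)) = bS at *
    generalize t'.ind (vd x (y - 1)) = cE at *
    generalize t'.ind (vd (x - 1) (y - 1)) = cW at *
    generalize t'.ind (hd (x - 1) y) = cN at *
    generalize t'.ind (hd (x - 1) (y - 1)) = cS at *
    constructor <;> omega

/-! ### Flip distance as total height difference -/

/-- The total height difference of two tilings. -/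
def gap (t t' : Tiling R) : ℕ := ∑ v ∈ R, (diff t t' v).natAbs

lemma gap_comm (t t' : Tiling R) : gap t t' = gap t' t := by
  unfold gap
  rw [diff_swap t t']
  simp

lemma gap_triangle (t t' t'' : Tiling R) : gap t t'' ≤ gap t t' + gap t' t'' := by
  unfold gap
  rw [← Finset.sum_add_distrib]
  refine Finset.sum_le_sum fun v _ => ?_
  rw [← diff_add_apply t t' t'']
  exact Int.natAbs_add_le _ _

lemma sum_natAbs_single {v : Vertex} (hv : v ∈ R) (k : ℤ) :
    ∑ w ∈ R, ((Pi.single v k : Vertex → ℤ) w).natAbs = k.natAbs := by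
  rw [Finset.sum_eq_single v]
  · simp
  · intro w _ hw
    simp [hw]
  · exact fun h => absurd hv h

lemma gap_of_adj {t t' : Tiling R} (h : (flipGraph R).Adj t t') : gap t t' = 1 := by
  rw [gap_comm]
  unfold gap
  obtain ⟨v, hv, h | h⟩ := flipGraph_adj_iff.1 h <;> rw [h, sum_natAbs_single hv.1] <;> rfl

lemma gap_le_length {t t' : Tiling R} (p : (flipGraph R).Walk t t') : gap t t' ≤ p.length := by
  induction p with
  | nil => simp [gap, diff_self]
  | @cons a b c h p ih =>
    have := gap_triangle a b c
    rw [gap_of_adj h] at this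
    rw [SimpleGraph.Walk.length_cons]
    omega

lemma sum_natAbs_add_single {f : Vertex → ℤ} {v : Vertex} (hv : v ∈ R) {k : ℤ}
    (h : (f v + k).natAbs + 1 = (f v).natAbs) :
    ∑ w ∈ R, ((f + Pi.single v k : Vertex → ℤ) w).natAbs + 1 = ∑ w ∈ R, (f w).natAbs := by
  rw [← Finset.sum_erase_add _ _ hv, ← Finset.sum_erase_add R (fun w => (f w).natAbs) hv, add_assoc]
  congr 1
  · refine Finset.sum_congr rfl fun w hw => ?_
    simp [(Finset.mem_erase.1 hw).1]
  · simpa using h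

/-- Lowering `t` or raising `t'` by one at a maximum vertex lowers the difference there from a
positive value, so the sum of absolute values drops by exactly one. -/
lemma exists_adj_of_pos {t t' : Tiling R} (hs : SameBoundary t t') {v : Vertex}
    (hv : 0 < diff t t' v) :
    (∃ s, (flipGraph R).Adj t s ∧ gap s t' + 1 = gap t t') ∨
      ∃ s, (flipGraph R).Adj t' s ∧ gap t s + 1 = gap t t' := by
  have hint : ∀ v, 0 < diff t t' v → IsInterior R v := by
    intro v hv
    by_contra h
    exact hv.ne' (hs v h)
  obtain ⟨w, hw, hmax⟩ := R.exists_max_image (diff t t') ⟨v, (hint v hv).1⟩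
  have hpos : 0 < diff t t' w := hv.trans_le (hmax v (hint v hv).1)
  have hle : ∀ u, diff t t' u ≤ diff t t' w := by
    intro u
    by_cases hu : 0 < diff t t' u
    · exact hmax u (hint u hu).1
    · omega
  obtain ⟨u, hu, ⟨s, h⟩ | ⟨s, h⟩⟩ := exists_flip_at_max hs hpos hle rfl
  · have hui := hint u (by omega)
    refine Or.inl ⟨s, flipGraph_adj_iff.2 ⟨u, hui, Or.inr h⟩, ?_⟩
    unfold gap
    rw [← diff_add s t t', h, add_comm (Pi.single u (-1))]
    exact sum_natAbs_add_single (f := diff t t') (v := u) (k := -1) hui.1 (by omega)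
  · have hui := hint u (by omega)
    refine Or.inr ⟨s, flipGraph_adj_iff.2 ⟨u, hui, Or.inl h⟩, ?_⟩
    unfold gap
    rw [← diff_add t t' s, diff_swap s t', h, ← Pi.single_neg]
    exact sum_natAbs_add_single (f := diff t t') (v := u) (k := -1) hui.1 (by omega)

/-- Induction on the gap. The improving flip may occur at either end of the walk; where the
difference is negative, the two tilings are interchanged. -/
lemma exists_walk_of_sameBoundary {t t' : Tiling R} (hs : SameBoundary t t') :
    ∃ p : (flipGraph R).Walk t t', p.length = gap t t' := by
  induction hn : gap t t' using Nat.strong_induction_on generalizing t t' with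
  | _ n ih =>
    by_cases h0 : diff t t' = 0
    · obtain rfl := SameBoundary.eq_of_diff_eq_zero h0
      refine ⟨.nil, ?_⟩
      rw [← hn]
      simp [gap, diff_self]
    · have hex : (∃ s, (flipGraph R).Adj t s ∧ gap s t' + 1 = gap t t') ∨
          ∃ s, (flipGraph R).Adj t' s ∧ gap t s + 1 = gap t t' := by
        obtain ⟨v, hv⟩ := Function.ne_iff.1 h0
        rw [Pi.zero_apply] at hv
        rcases lt_or_gt_of_ne hv with hv | hv
        · have hv' : 0 < diff t' t v := by rw [diff_swap, Pi.neg_apply]; omega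
          rcases exists_adj_of_pos hs.symm hv' with ⟨s, h1, h2⟩ | ⟨s, h1, h2⟩
          · exact Or.inr ⟨s, h1, by rw [gap_comm t s, gap_comm t t', h2]⟩
          · exact Or.inl ⟨s, h1, by rw [gap_comm s t', gap_comm t t', h2]⟩
        · exact exists_adj_of_pos hs hv
      rcases hex with ⟨s, ha, hg⟩ | ⟨s, ha, hg⟩
      · obtain ⟨p, hp⟩ := ih (gap s t') (by omega)
          ((SameBoundary.of_reachable ha.reachable).symm.trans hs) rfl
        exact ⟨.cons ha p, by rw [SimpleGraph.Walk.length_cons]; omega⟩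
      · obtain ⟨p, hp⟩ := ih (gap t s) (by omega)
          (hs.trans (SameBoundary.of_reachable ha.reachable)) rfl
        exact ⟨p.concat ha.symm, by rw [SimpleGraph.Walk.length_concat]; omega⟩

lemma reachable_iff_sameBoundary {t t' : Tiling R} :
    (flipGraph R).Reachable t t' ↔ SameBoundary t t' := by
  refine ⟨SameBoundary.of_reachable, fun h => ?_⟩
  obtain ⟨p, _⟩ := exists_walk_of_sameBoundary h
  exact ⟨p⟩

lemma SameBoundary.dist_eq {t t' : Tiling R} (hs : SameBoundary t t') :
    (flipGraph R).dist t t' = gap t t' := by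
  obtain ⟨p, hp⟩ := exists_walk_of_sameBoundary hs
  obtain ⟨q, hq⟩ := (reachable_iff_sameBoundary.2 hs).exists_walk_length_eq_dist
  have h1 := SimpleGraph.dist_le p
  have h2 := gap_le_length q
  omega

/-! ### Grid edges, flows and cuts -/

lemma leftCell_east (x y : ℤ) : leftCell (x, y) (x + 1, y) = (x, y) := by simp [leftCell]

lemma leftCell_west (x y : ℤ) : leftCell (x + 1, y) (x, y) = (x, y - 1) := by
  simp [leftCell, show x ≠ x + 1 + 1 by omega]

lemma leftCell_north (x y : ℤ) : leftCell (x, y) (x, y + 1) = (x - 1, y) := by simp [leftCell]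

lemma leftCell_south (x y : ℤ) : leftCell (x, y + 1) (x, y) = (x, y) := by
  simp [leftCell, show y ≠ y + 1 + 1 by omega, show x ≠ x - 1 by omega]

lemma gridGraph_adj_east (x y : ℤ) : gridGraph.Adj (x, y) (x + 1, y) := by simp [gridGraph]

lemma gridGraph_adj_north (x y : ℤ) : gridGraph.Adj (x, y) (x, y + 1) := by simp [gridGraph]

lemma gridGraph_adj_cases {P : Vertex → Vertex → Prop} (east : ∀ x y, P (x, y) (x + 1, y))
    (west : ∀ x y, P (x + 1, y) (x, y)) (north : ∀ x y, P (x, y) (x, y + 1))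
    (south : ∀ x y, P (x, y + 1) (x, y)) {v w : Vertex} (h : gridGraph.Adj v w) : P v w := by
  obtain ⟨a, b⟩ := v
  obtain ⟨x, y⟩ := w
  have h' : |x - a| + |y - b| = 1 := h
  have : (x = a + 1 ∧ y = b) ∨ (a = x + 1 ∧ y = b) ∨ (x = a ∧ y = b + 1) ∨ (x = a ∧ b = y + 1) := by
    rcases abs_cases (x - a) with h1 | h1 <;> rcases abs_cases (y - b) with h2 | h2 <;> omega
  rcases this with ⟨rfl, rfl⟩ | ⟨rfl, rfl⟩ | ⟨rfl, rfl⟩ | ⟨rfl, rfl⟩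
  · exact east _ _
  · exact west _ _
  · exact north _ _
  · exact south _ _

/-- The domino crossing a grid edge. -/
def edgeDomino (v w : Vertex) : Finset Cell := {leftCell v w, leftCell w v}

lemma edgeDomino_comm (v w : Vertex) : edgeDomino w v = edgeDomino v w := Finset.pair_comm _ _

lemma edgeDomino_east (x y : ℤ) : edgeDomino (x, y) (x + 1, y) = vd x (y - 1) := by
  rw [edgeDomino, leftCell_east, leftCell_west, vd, sub_add_cancel, Finset.pair_comm]

lemma edgeDomino_north (x y : ℤ) : edgeDomino (x, y) (x, y + 1) = hd (x - 1) y := by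
  rw [edgeDomino, leftCell_north, leftCell_south, hd, sub_add_cancel]

lemma colour_leftCell_swap {v w : Vertex} (h : gridGraph.Adj v w) :
    colour (leftCell w v) = -colour (leftCell v w) := by
  revert h
  refine fun h => gridGraph_adj_cases (P := fun v w => colour (leftCell w v) =
    -colour (leftCell v w)) ?_ ?_ ?_ ?_ h <;> intro x y <;>
    simp only [leftCell_east, leftCell_west, leftCell_north, leftCell_south, colour_south,
      colour_west, neg_neg]

lemma Tiling.crosses_iff {t : Tiling R} {v w : Vertex} :
    t.Crosses v w ↔ t.ind (edgeDomino v w) = 1 := Tiling.ind_eq_one.symm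

lemma diff_step (t t' : Tiling R) {v w : Vertex} (h : gridGraph.Adj v w) : diff t t' w =
    diff t t' v + colour (leftCell v w) * (t.ind (edgeDomino v w) - t'.ind (edgeDomino v w)) := by
  refine gridGraph_adj_cases (P := fun v w => diff t t' w = diff t t' v + colour (leftCell v w) *
    (t.ind (edgeDomino v w) - t'.ind (edgeDomino v w))) ?_ ?_ ?_ ?_ h <;> intro x y
  · rw [leftCell_east, edgeDomino_east, diff_east]
  · rw [leftCell_west, edgeDomino_comm, edgeDomino_east, diff_east, colour_south]
    ring
  · rw [leftCell_north, edgeDomino_north, diff_north, colour_west]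
    ring
  · rw [leftCell_south, edgeDomino_comm, edgeDomino_north, diff_north]
    ring

lemma edgeDomino_subset {v w : Vertex} :
    edgeDomino v w ⊆ R ↔ leftCell v w ∈ R ∧ leftCell w v ∈ R := by
  simp [edgeDomino, Finset.insert_subset_iff]

lemma Tiling.ind_edgeDomino_eq_zero (t : Tiling R) {v w : Vertex}
    (h : ¬ (leftCell v w ∈ R ∧ leftCell w v ∈ R)) : t.ind (edgeDomino v w) = 0 := by
  rw [Tiling.ind_eq_zero]
  exact fun h' => h (edgeDomino_subset.1 (t.subset _ h'))

/-- The flow adds colour times indicator over the edges of the path, which is how `diff` increases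
along each edge. -/
lemma flow_sub_flow (t t' : Tiling R) {u v : Vertex} (p : (edgeGraph R).Walk u v) :
    t.flow p - t'.flow p = diff t t' v - diff t t' u := by
  induction p with
  | nil => simp [Tiling.flow]
  | @cons a b c h p ih =>
    have hstep := diff_step t t' h.1
    have hterm : ∀ s : Tiling R, (if s.Crosses a b then colour (leftCell a b) else 0) =
        colour (leftCell a b) * s.ind (edgeDomino a b) := by
      intro s
      rcases s.ind_eq_or (edgeDomino a b) with h' | h' <;> simp [Tiling.crosses_iff, h']
    have hcons : ∀ s : Tiling R, s.flow (SimpleGraph.Walk.cons h p) =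
        colour (leftCell a b) * s.ind (edgeDomino a b) + s.flow p := by
      intro s
      rw [← hterm]
      simp [Tiling.flow]
    rw [hcons, hcons]
    linear_combination ih - hstep

/-- Some square of `R` has the corner `v`. -/
def Touches (R : Finset Cell) (v : Vertex) : Prop :=
  (v.1, v.2) ∈ R ∨ (v.1 - 1, v.2) ∈ R ∨ (v.1, v.2 - 1) ∈ R ∨ (v.1 - 1, v.2 - 1) ∈ R

lemma IsBoundaryVertex.not_isInterior {v : Vertex} (h : IsBoundaryVertex R v) :
    ¬ IsInterior R v := by
  obtain ⟨w, hg, hx⟩ := h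
  revert hx
  refine gridGraph_adj_cases (P := fun v w => Xor (leftCell v w ∈ R) (leftCell w v ∈ R) →
    ¬ IsInterior R v) ?_ ?_ ?_ ?_ hg <;> intro x y <;>
    simp only [leftCell_east, leftCell_west, leftCell_north, leftCell_south, IsInterior, xor_def,
      add_sub_cancel_right] <;> tauto

/-- If no edge at `v` is a boundary edge, membership in `R` agrees across each of the four edges,
hence for all four squares around `v`. -/
lemma isBoundaryVertex_of_touches {v : Vertex} (h : Touches R v) (hi : ¬ IsInterior R v) :
    IsBoundaryVertex R v := by
  obtain ⟨x, y⟩ := v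
  unfold Touches at h
  unfold IsInterior at hi
  dsimp only at h hi
  by_contra hb
  have key : ∀ w, gridGraph.Adj (x, y) w → (leftCell (x, y) w ∈ R ↔ leftCell w (x, y) ∈ R) := by
    intro w hw
    by_contra hx
    exact hb ⟨w, hw, by rw [xor_def]; tauto⟩
  have e := key _ (gridGraph_adj_east x y)
  have n := key _ (gridGraph_adj_north x y)
  have w := key (x - 1, y) (by simpa using (gridGraph_adj_east (x - 1) y).symm)
  have s := key (x, y - 1) (by simpa using (gridGraph_adj_north x (y - 1)).symm)
  have w1 := leftCell_east (x - 1) y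
  have w2 := leftCell_west (x - 1) y
  have s1 := leftCell_north x (y - 1)
  have s2 := leftCell_south x (y - 1)
  rw [sub_add_cancel] at w1 w2 s1 s2
  rw [leftCell_east, leftCell_west] at e
  rw [leftCell_north, leftCell_south] at n
  rw [w1, w2] at w
  rw [s1, s2] at s
  tauto

lemma edgeGraph_adj_east {x y : ℤ} :
    (edgeGraph R).Adj (x, y) (x + 1, y) ↔ (x, y) ∈ R ∨ (x, y - 1) ∈ R := by
  have : (edgeGraph R).Adj (x, y) (x + 1, y) ↔ gridGraph.Adj (x, y) (x + 1, y) ∧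
    (leftCell (x, y) (x + 1, y) ∈ R ∨ leftCell (x + 1, y) (x, y) ∈ R) := Iff.rfl
  rw [this, leftCell_east, leftCell_west, and_iff_right (gridGraph_adj_east x y)]

lemma diff_eq_of_boundaryGraph_reachable (t t' : Tiling R) {u v : Vertex}
    (h : (boundaryGraph R).Reachable u v) : diff t t' u = diff t t' v := by
  obtain ⟨p⟩ := h
  induction p with
  | nil => rfl
  | @cons a b c h p ih =>
    rw [← ih, diff_step t t' h.1, t.ind_edgeDomino_eq_zero, t'.ind_edgeDomino_eq_zero]
    · simp
    all_goals
      have := h.2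
      rw [xor_def] at this
      tauto

/-- Two boundary vertices in one connected piece of `R` lie on the same boundary component, where
the difference is constant, or are joined by a cut, across which the flows agree. So the difference
takes one value on the boundary of each piece, and that value is zero by comparison with the far
west. -/
lemma sameBoundary_of_flow_eq {t t' : Tiling R}
    (hflow : ∀ (u v : Vertex) (p : (edgeGraph R).Walk u v), IsCut p → t.flow p = t'.flow p) :
    SameBoundary t t' := by
  have key : ∀ u v, IsBoundaryVertex R u → IsBoundaryVertex R v → (edgeGraph R).Reachable u v →
      diff t t' u = diff t t' v := by
    intro u v hu hv huv
    by_cases hb : (boundaryGraph R).Reachable u v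
    · exact diff_eq_of_boundaryGraph_reachable t t' hb
    · obtain ⟨p, hp⟩ := huv.exists_isPath
      have h1 := flow_sub_flow t t' p
      rw [hflow u v p ⟨hp, hu, hv, hb⟩] at h1
      omega
  -- The second clause carries the normalization through the interior by remembering a boundary
  -- vertex of difference zero in the same piece. Where the eastward edge is not an edge of `R`, no
  -- domino crosses it and the difference stays the same.
  have main : ∀ x y : ℤ, (¬ IsInterior R (x, y) → diff t t' (x, y) = 0) ∧
      (IsInterior R (x, y) → ∃ u, IsBoundaryVertex R u ∧ diff t t' u = 0 ∧
        (edgeGraph R).Reachable (x, y) u) := by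
    intro x y
    induction x, y using west_induction (R := R) with
    | base x y h =>
      refine ⟨fun _ => potential_eq_zero_of_west _ h, fun hi => ?_⟩
      have := h _ hi.2.1
      dsimp at this
      omega
    | step x y ih =>
      obtain ⟨ih1, ih2⟩ := ih
      by_cases he : (x, y) ∈ R ∨ (x, y - 1) ∈ R
      · have hadj := (edgeGraph_adj_east.2 he).symm.reachable
        have htouch : Touches R (x, y) := by unfold Touches; tauto
        have htouch' : Touches R (x + 1, y) := by
          unfold Touches
          simp only [add_sub_cancel_right]
          tauto
        obtain ⟨u, hu, hu0, hxu⟩ : ∃ u, IsBoundaryVertex R u ∧ diff t t' u = 0 ∧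
            (edgeGraph R).Reachable (x, y) u := by
          by_cases hi : IsInterior R (x, y)
          · exact ih2 hi
          · exact ⟨_, isBoundaryVertex_of_touches htouch hi, ih1 hi, .refl _⟩
        refine ⟨fun hi => ?_, fun _ => ⟨u, hu, hu0, hadj.trans hxu⟩⟩
        rw [key _ _ (isBoundaryVertex_of_touches htouch' hi) hu (hadj.trans hxu), hu0]
      · have hne : ¬ IsInterior R (x, y) := fun hi => he (Or.inl hi.1)
        have hne' : ¬ IsInterior R (x + 1, y) := fun hi => he (Or.inl (by simpa using hi.2.1))
        refine ⟨fun _ => ?_, fun hi => absurd hi hne'⟩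
        have h0 : ∀ s : Tiling R, s.ind (vd x (y - 1)) = 0 := fun s =>
          s.isSupported_ind.vd_eq_zero (Or.inr (by rw [sub_add_cancel]; tauto))
        rw [diff_east, ih1 hne, h0, h0]
        simp
  exact fun v hv => (main v.1 v.2).1 hv

lemma sameBoundary_iff_flow_eq {t t' : Tiling R} : SameBoundary t t' ↔
    ∀ (u v : Vertex) (p : (edgeGraph R).Walk u v), IsCut p → t.flow p = t'.flow p := by
  refine ⟨fun h u v p hp => ?_, sameBoundary_of_flow_eq⟩
  have := flow_sub_flow t t' p
  rw [h v hp.2.2.1.not_isInterior, h u hp.2.1.not_isInterior] at this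
  omega

/-! ### Height sections -/

/-- The height bundle in which the tiling `t` has the section zero. -/
def Tiling.bundle (t : Tiling R) : HeightBundle R where
  shift v w := -(colour (leftCell v w) * (1 - 4 * t.ind (edgeDomino v w)))
  shift_symm v w h := by
    rw [edgeDomino_comm, colour_leftCell_swap h.1]
    ring
  flat := by
    rintro ⟨x, y⟩ hc
    have h := t.cellSum_ind hc
    unfold cellSum at h
    simp only [Prod.mk_add_mk, add_zero]
    rw [edgeDomino_comm (x, y + 1) (x + 1, y + 1), edgeDomino_comm (x, y) (x, y + 1),
      edgeDomino_east, edgeDomino_east, edgeDomino_north, edgeDomino_north, leftCell_east,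
      leftCell_west, leftCell_north, leftCell_south]
    simp only [add_sub_cancel_right]
    linear_combination (4 * colour (x, y)) * h

/-- Crossing a domino changes the height by -3 instead of 1 times the colour sign, hence the factor
-4 per unit of indicator. -/
lemma Tiling.isHeightSection_bundle (t₀ t : Tiling R) :
    IsHeightSection t₀.bundle t fun v => -4 * diff t t₀ v := by
  intro v w h hc
  have h0 : t.ind (edgeDomino v w) = 0 := Tiling.ind_eq_zero.2 hc
  have := diff_step t t₀ h.1
  rw [h0] at this
  simp only [Tiling.bundle]
  linear_combination (-4) * this

/-- The definition prescribes three sides of each square of `R`; flatness and the fact that exactly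
one side is crossed determine the fourth. Every edge of `R` is a side of some square of `R`. -/
lemma IsHeightSection.step {L : HeightBundle R} {t : Tiling R} {θ : Vertex → ℤ}
    (hθ : IsHeightSection L t θ) {v w : Vertex} (h : (edgeGraph R).Adj v w) :
    θ w = θ v + L.shift v w + colour (leftCell v w) * (1 - 4 * t.ind (edgeDomino v w)) := by
  have zero : ∀ v w, (edgeGraph R).Adj v w → t.ind (edgeDomino v w) = 0 →
      θ w = θ v + L.shift v w + colour (leftCell v w) := fun v w h h0 =>
    hθ v w h (Tiling.ind_eq_zero.1 h0)
  have cell : ∀ x y, (x, y) ∈ R →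
      θ (x + 1, y) = θ (x, y) + L.shift (x, y) (x + 1, y) +
        colour (x, y) * (1 - 4 * t.ind (vd x (y - 1))) ∧
      θ (x + 1, y + 1) = θ (x + 1, y) + L.shift (x + 1, y) (x + 1, y + 1) +
        colour (x, y) * (1 - 4 * t.ind (hd x y)) ∧
      θ (x, y + 1) = θ (x + 1, y + 1) + L.shift (x + 1, y + 1) (x, y + 1) +
        colour (x, y) * (1 - 4 * t.ind (vd x y)) ∧
      θ (x, y) = θ (x, y + 1) + L.shift (x, y + 1) (x, y) +
        colour (x, y) * (1 - 4 * t.ind (hd (x - 1) y)) := by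
    intro x y hc
    have hflat := L.flat (x, y) hc
    simp only [Prod.mk_add_mk, add_zero] at hflat
    have hsum := t.cellSum_ind hc
    unfold cellSum at hsum
    have a1 : (edgeGraph R).Adj (x, y) (x + 1, y) :=
      ⟨gridGraph_adj_east x y, Or.inl (by rwa [leftCell_east])⟩
    have a2 : (edgeGraph R).Adj (x + 1, y) (x + 1, y + 1) :=
      ⟨gridGraph_adj_north _ _, Or.inl (by rwa [leftCell_north, add_sub_cancel_right])⟩
    have a3 : (edgeGraph R).Adj (x + 1, y + 1) (x, y + 1) :=
      ⟨(gridGraph_adj_east _ _).symm, Or.inl (by rwa [leftCell_west, add_sub_cancel_right])⟩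
    have a4 : (edgeGraph R).Adj (x, y + 1) (x, y) :=
      ⟨(gridGraph_adj_north _ _).symm, Or.inl (by rwa [leftCell_south])⟩
    have z1 := zero _ _ a1
    have z2 := zero _ _ a2
    have z3 := zero _ _ a3
    have z4 := zero _ _ a4
    rw [edgeDomino_east, leftCell_east] at z1
    rw [edgeDomino_north, leftCell_north, add_sub_cancel_right] at z2
    rw [edgeDomino_comm, edgeDomino_east, leftCell_west, add_sub_cancel_right] at z3
    rw [edgeDomino_comm, edgeDomino_north, leftCell_south] at z4
    rcases t.ind_eq_or (vd x (y - 1)) with i1 | i1 <;> rcases t.ind_eq_or (hd x y) with i2 | i2 <;>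
    rcases t.ind_eq_or (vd x y) with i3 | i3 <;>
    rcases t.ind_eq_or (hd (x - 1) y) with i4 | i4 <;> 
    simp only [i1, i2, i3, i4, true_implies, mul_zero, mul_one, sub_zero] at hsum z1 z2 z3 z4 ⊢ <;>
    omega
  refine gridGraph_adj_cases (P := fun v w => (edgeGraph R).Adj v w → θ w = θ v + L.shift v w +
    colour (leftCell v w) * (1 - 4 * t.ind (edgeDomino v w))) ?_ ?_ ?_ ?_ h.1 h <;>
    intro x y hadj
  · rw [leftCell_east, edgeDomino_east]
    rcases edgeGraph_adj_east.1 hadj with hc | hc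
    · exact (cell x y hc).1
    · have := (cell x (y - 1) hc).2.2.1
      rw [sub_add_cancel, L.shift_symm _ _ hadj, colour_south] at this
      linarith
  · rw [leftCell_west, edgeDomino_comm, edgeDomino_east, L.shift_symm _ _ hadj.symm]
    rcases edgeGraph_adj_east.1 hadj.symm with hc | hc
    · have := (cell x y hc).1
      rw [colour_south]
      linarith
    · have := (cell x (y - 1) hc).2.2.1
      rw [sub_add_cancel, L.shift_symm _ _ hadj.symm] at this
      linarith
  · have hc := hadj.2
    rw [leftCell_north, leftCell_south] at hc
    rw [leftCell_north, edgeDomino_north]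
    rcases hc with hc | hc
    · have := (cell (x - 1) y hc).2.1
      rw [sub_add_cancel] at this
      linarith
    · have := (cell x y hc).2.2.2
      rw [L.shift_symm _ _ hadj] at this
      rw [colour_west]
      linarith
  · have hc := hadj.2
    rw [leftCell_north, leftCell_south] at hc
    rw [leftCell_south, edgeDomino_comm, edgeDomino_north]
    rcases hc with hc | hc
    · exact (cell x y hc).2.2.2
    · have := (cell (x - 1) y hc).2.1
      rw [sub_add_cancel, L.shift_symm _ _ hadj, colour_west] at this
      linarith

/-- Two sections of the same bundle that agree on the boundary differ by `-4` times the height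
difference. -/
lemma IsHeightSection.sub_eq {L : HeightBundle R} {t t' : Tiling R} {θ θ' : Vertex → ℤ}
    (hθ : IsHeightSection L t θ) (hθ' : IsHeightSection L t' θ') (hs : SameBoundary t t')
    (hb : ∀ v, IsBoundaryVertex R v → θ v = θ' v) {v : Vertex} (hv : Touches R v) :
    θ v - θ' v = -4 * diff t t' v := by
  have hbd : ∀ v, Touches R v → ¬ IsInterior R v → θ v - θ' v = -4 * diff t t' v := by
    intro v h1 h2
    rw [hb v (isBoundaryVertex_of_touches h1 h2), hs v h2]
    simp
  have main : ∀ x y : ℤ, Touches R (x, y) → θ (x, y) - θ' (x, y) = -4 * diff t t' (x, y) := by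
    intro x y
    induction x, y using west_induction (R := R) with
    | base x y h =>
      refine fun ht => hbd _ ht fun hi => ?_
      have := h _ hi.2.1
      dsimp at this
      omega
    | step x y ih =>
      intro ht
      -- The edge entering an interior vertex from the west belongs to `R`, and both sides of the
      -- identity change equally along it. A non-interior vertex that touches `R` lies on the
      -- boundary.
      by_cases hi : IsInterior R (x + 1, y)
      · have hc : (x, y) ∈ R := by simpa using hi.2.1
        have hadj := edgeGraph_adj_east.2 (Or.inl hc : (x, y) ∈ R ∨ (x, y - 1) ∈ R)
        have h1 := hθ.step hadj
        have h2 := hθ'.step hadj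
        have h3 := diff_step t t' hadj.1
        have h4 := ih (Or.inl hc)
        linear_combination h1 - h2 + 4 * h3 + h4
      · exact hbd _ ht hi
  exact main v.1 v.2 hv

lemma touches_of_mem_vertices {v : Vertex} (h : v ∈ vertices R) : Touches R v := by
  simp only [vertices, Finset.mem_biUnion, Finset.mem_insert, Finset.mem_singleton] at h
  obtain ⟨c, hc, rfl | rfl | rfl | rfl⟩ := h <;> simp [Touches, hc]

lemma subset_vertices : R ⊆ vertices R := fun c hc =>
  Finset.mem_biUnion.2 ⟨c, hc, by simp⟩

lemma dist_eq_sum_sections {t t' : Tiling R} (hs : SameBoundary t t') {L : HeightBundle R}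
    {θ θ' : Vertex → ℤ} (hθ : IsHeightSection L t θ) (hθ' : IsHeightSection L t' θ')
    (hb : ∀ v, IsBoundaryVertex R v → θ v = θ' v) :
    ((flipGraph R).dist t t' : ℚ) = 1 / 4 * ∑ v ∈ vertices R, |(θ v : ℚ) - (θ' v : ℚ)| := by
  have hterm : ∀ v ∈ vertices R, |(θ v : ℚ) - (θ' v : ℚ)| = 4 * ((diff t t' v).natAbs : ℚ) := by
    intro v hv
    have h := hθ.sub_eq hθ' hs hb (touches_of_mem_vertices hv)
    rw [← Int.cast_sub, h, Nat.cast_natAbs]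
    push_cast
    rw [abs_mul]
    norm_num
  rw [Finset.sum_congr rfl hterm, ← Finset.mul_sum, hs.dist_eq, gap,
    ← Finset.sum_subset (subset_vertices (R := R))]
  · push_cast
    ring
  · intro v _ hv
    rw [hs v fun h => hv h.1]
    simp

/-- Any tiling serves as reference; when there is none, the trivial bundle works vacuously. -/
lemma exists_bundle_sections (R : Finset Cell) :
    ∃ (L : HeightBundle R) (θ : Tiling R → Vertex → ℤ), (∀ t, IsHeightSection L t (θ t)) ∧
      ∀ t₁ t₂, (flipGraph R).Reachable t₁ t₂ → ∀ v, IsBoundaryVertex R v → θ t₁ v = θ t₂ v := by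
  by_cases hne : Nonempty (Tiling R)
  · obtain ⟨t₀⟩ := hne
    refine ⟨t₀.bundle, fun t v => -4 * diff t t₀ v, t₀.isHeightSection_bundle, ?_⟩
    intro t₁ t₂ h v hv
    have h1 := diff_add_apply t₁ t₂ t₀ v
    rw [reachable_iff_sameBoundary.1 h v hv.not_isInterior, zero_add] at h1
    simp only [h1]
  · exact ⟨⟨fun _ _ => 0, by simp, by simp⟩, fun _ _ => 0, fun t => absurd ⟨t⟩ hne,
      fun t => absurd ⟨t⟩ hne⟩

/-! ### Real height functions -/

/-- A real number that is an integer. -/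
def IsInt (r : ℝ) : Prop := ∃ k : ℤ, (k : ℝ) = r

lemma isInt_intCast (k : ℤ) : IsInt (k : ℝ) := ⟨k, rfl⟩

/-- Admissible heights `p`, `q` at the endpoints of an edge whose domino has indicator `a` in the
reference tiling: the weight of the domino stays in `[0, 1]`, and only one end is moving. -/
def EdgeOK (a s : ℤ) (p q : ℝ) : Prop :=
  0 ≤ a + s * (q - p) ∧ a + s * (q - p) ≤ 1 ∧ (IsInt p ∨ IsInt q)

lemma EdgeOK.swap {a s : ℤ} {p q : ℝ} (h : EdgeOK a s p q) : EdgeOK a (-s) q p := by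
  obtain ⟨h1, h2, h3⟩ := h
  refine ⟨?_, ?_, h3.symm⟩ <;> push_cast <;> linarith

lemma isInt_neg_iff {p : ℝ} : IsInt (-p) ↔ IsInt p :=
  ⟨fun ⟨k, hk⟩ => ⟨-k, by push_cast; linarith⟩, fun ⟨k, hk⟩ => ⟨-k, by push_cast; linarith⟩⟩

lemma EdgeOK.neg {a s : ℤ} {p q : ℝ} (h : EdgeOK a s p q) : EdgeOK a (-s) (-p) (-q) := by
  obtain ⟨h1, h2, h3⟩ := h
  refine ⟨?_, ?_, by rwa [isInt_neg_iff, isInt_neg_iff]⟩ <;> push_cast <;> linarith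

/-- The weight bounds follow by comparison with the two given pairs. If neither `p₁` nor `q₂` were
an integer, then `q₁ = k` and `p₂ = m` would be, and the bounds, made strict by non-integrality,
would give both m > a + k - 1 and m < a + k. -/
lemma EdgeOK.min_cross {a : ℤ} {p₁ q₁ p₂ q₂ : ℝ} (h₁ : EdgeOK a 1 p₁ q₁) (h₂ : EdgeOK a 1 p₂ q₂)
    (hp : p₁ ≤ p₂) (hq : q₂ ≤ q₁) : EdgeOK a 1 p₁ q₂ := by
  obtain ⟨a1, a2, a3⟩ := h₁
  obtain ⟨b1, b2, b3⟩ := h₂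
  simp only [Int.cast_one, one_mul] at a1 a2 b1 b2
  refine ⟨by push_cast; linarith, by push_cast; linarith, ?_⟩
  by_contra hcon
  rw [not_or] at hcon
  obtain ⟨k, hk⟩ := a3.resolve_left hcon.1
  obtain ⟨m, hm⟩ := b3.resolve_right hcon.2
  have e1 : p₁ ≠ ((a + k - 1 : ℤ) : ℝ) := fun h => hcon.1 ⟨_, h.symm⟩
  have e2 : q₂ ≠ (k : ℝ) := fun h => hcon.2 ⟨_, h.symm⟩
  push_cast at e1
  have l1 : (a : ℝ) + k - 1 < p₁ := lt_of_le_of_ne (by linarith) e1.symm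
  have l2 : q₂ < k := lt_of_le_of_ne (by linarith) e2
  have l3 : a + k - 1 < m := by
    have : ((a + k - 1 : ℤ) : ℝ) < m := by push_cast; linarith
    exact_mod_cast this
  have l4 : m - a < k := by
    have : ((m - a : ℤ) : ℝ) < k := by push_cast; linarith
    exact_mod_cast this
  omega

lemma EdgeOK.min_one {a : ℤ} {p₁ q₁ p₂ q₂ : ℝ} (h₁ : EdgeOK a 1 p₁ q₁) (h₂ : EdgeOK a 1 p₂ q₂) :
    EdgeOK a 1 (min p₁ p₂) (min q₁ q₂) := by
  rcases le_total p₁ p₂ with hp | hp <;> rcases le_total q₁ q₂ with hq | hq <;>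
    simp only [min_eq_left, min_eq_right, hp, hq]
  · exact h₁
  · exact h₁.min_cross h₂ hp hq
  · exact h₂.min_cross h₁ hp hq
  · exact h₂

lemma EdgeOK.min {a s : ℤ} (hs : s = 1 ∨ s = -1) {p₁ q₁ p₂ q₂ : ℝ} (h₁ : EdgeOK a s p₁ q₁)
    (h₂ : EdgeOK a s p₂ q₂) : EdgeOK a s (min p₁ p₂) (min q₁ q₂) := by
  rcases hs with rfl | rfl
  · exact h₁.min_one h₂
  · exact (EdgeOK.min_one (by simpa using h₁.swap) (by simpa using h₂.swap)).swap

lemma EdgeOK.max {a s : ℤ} (hs : s = 1 ∨ s = -1) {p₁ q₁ p₂ q₂ : ℝ} (h₁ : EdgeOK a s p₁ q₁)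
    (h₂ : EdgeOK a s p₂ q₂) : EdgeOK a s (max p₁ p₂) (max q₁ q₂) := by
  have := (EdgeOK.min (s := -s) (by omega) h₁.neg h₂.neg).neg
  simpa [min_neg_neg] using this

/-- With one end an integer, the weight condition bounds the other end by integers, and integer
bounds survive floor and ceiling. -/
lemma EdgeOK.round_one {a : ℤ} {p q : ℝ} (h : EdgeOK a 1 p q) {k l : ℤ} (hk : ⌊p⌋ ≤ k)
    (hk' : k ≤ ⌈p⌉) (hl : ⌊q⌋ ≤ l) (hl' : l ≤ ⌈q⌉) : 0 ≤ a + (l - k) ∧ a + (l - k) ≤ 1 := by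
  obtain ⟨h1, h2, ⟨m, rfl⟩ | ⟨m, rfl⟩⟩ := h
  · simp only [Int.floor_intCast, Int.ceil_intCast] at hk hk'
    obtain rfl : k = m := by omega
    have e1 : k - a ≤ ⌊q⌋ := Int.le_floor.2 (by push_cast at h1 ⊢; linarith)
    have e2 : ⌈q⌉ ≤ k + 1 - a := Int.ceil_le.2 (by push_cast at h2 ⊢; linarith)
    omega
  · simp only [Int.floor_intCast, Int.ceil_intCast] at hl hl'
    obtain rfl : l = m := by omega
    have e1 : a + l - 1 ≤ ⌊p⌋ := Int.le_floor.2 (by push_cast at h2 ⊢; linarith)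
    have e2 : ⌈p⌉ ≤ a + l := Int.ceil_le.2 (by push_cast at h1 ⊢; linarith)
    omega

/-- Rounding admissible heights keeps them admissible. -/
lemma EdgeOK.round {a s : ℤ} (hs : s = 1 ∨ s = -1) {p q : ℝ} (h : EdgeOK a s p q) {k l : ℤ}
    (hk : ⌊p⌋ ≤ k) (hk' : k ≤ ⌈p⌉) (hl : ⌊q⌋ ≤ l) (hl' : l ≤ ⌈q⌉) :
    a + s * (l - k) = 0 ∨ a + s * (l - k) = 1 := by
  rcases hs with rfl | rfl
  · have := h.round_one hk hk' hl hl'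
    omega
  · have := EdgeOK.round_one (by simpa using h.swap) hl hl' hk hk'
    omega

lemma edgeOK_intCast {a s k l : ℤ} (h : a + s * (l - k) = 0 ∨ a + s * (l - k) = 1) :
    EdgeOK a s k l := by
  refine ⟨?_, ?_, Or.inl (isInt_intCast k)⟩
  · have : 0 ≤ a + s * (l - k) := by omega
    exact_mod_cast this
  · have : a + s * (l - k) ≤ 1 := by omega
    exact_mod_cast this

/-- Heights moving along a cube, of which at most one coordinate affects the given edge. -/
lemma edgeOK_of_sum {ι : Type*} {a s P Q : ℤ} (S : Finset ι) (c : ι → ℝ)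
    (hc : ∀ i, c i ∈ Set.Icc (0 : ℝ) 1) (f g : ι → ℤ)
    (h0 : a + s * (Q - P) = 0 ∨ a + s * (Q - P) = 1)
    (h1 : ∀ i ∈ S, a + s * ((Q + g i) - (P + f i)) = 0 ∨ a + s * ((Q + g i) - (P + f i)) = 1)
    (hfg : ∀ i ∈ S, f i = 0 ∨ g i = 0)
    (huniq : ∀ i ∈ S, ∀ j ∈ S, (f i ≠ 0 ∨ g i ≠ 0) → (f j ≠ 0 ∨ g j ≠ 0) → i = j) :
    EdgeOK a s (P + ∑ i ∈ S, c i * f i) (Q + ∑ i ∈ S, c i * g i) := by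
  by_cases hex : ∃ i ∈ S, f i ≠ 0 ∨ g i ≠ 0
  · obtain ⟨i, hi, hne⟩ := hex
    have hz : ∀ j ∈ S, j ≠ i → f j = 0 ∧ g j = 0 := by
      intro j hj hji
      by_contra h
      exact hji (huniq j hj i hi (by tauto) hne)
    rw [Finset.sum_eq_single_of_mem i hi fun j hj hji => by rw [(hz j hj hji).1]; simp,
      Finset.sum_eq_single_of_mem i hi fun j hj hji => by rw [(hz j hj hji).2]; simp]
    have e0 := edgeOK_intCast h0
    have e1 := edgeOK_intCast (h1 i hi)
    obtain ⟨a1, a2, _⟩ := e0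
    obtain ⟨b1, b2, _⟩ := e1
    push_cast at b1 b2
    obtain ⟨c0, c1⟩ := hc i
    -- The weight is a convex combination of its values before and after the single move that
    -- affects this edge.
    have key : (a : ℝ) + s * ((Q + c i * g i) - (P + c i * f i)) =
        (1 - c i) * (a + s * (Q - P)) + c i * (a + s * ((Q + g i) - (P + f i))) := by ring
    refine ⟨?_, ?_, ?_⟩
    · rw [key]
      exact add_nonneg (mul_nonneg (by linarith) a1) (mul_nonneg c0 b1)
    · rw [key]
      nlinarith
    · rcases hfg i hi with h | h
      · left
        simpa [h] using isInt_intCast P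
      · right
        simpa [h] using isInt_intCast Q
  · have hz : ∀ j ∈ S, f j = 0 ∧ g j = 0 := by
      intro j hj
      by_contra h
      exact hex ⟨j, hj, by tauto⟩
    rw [Finset.sum_eq_zero fun j hj => by rw [(hz j hj).1]; simp,
      Finset.sum_eq_zero fun j hj => by rw [(hz j hj).2]; simp, add_zero, add_zero]
    exact edgeOK_intCast h0

/-! ### The lattice of real heights and its extreme tilings -/

/-- The real height functions, relative to `t₀`, of the points of the complex in the component
of `t₀`. -/
def realHeights (t₀ : Tiling R) : Set (Vertex → ℝ) :=
  {h | VanishesOutside R h ∧ ∀ x y : ℤ,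
    EdgeOK (t₀.ind (hd x y)) (colour (x, y)) (h (x + 1, y)) (h (x + 1, y + 1)) ∧
    EdgeOK (t₀.ind (vd x y)) (-colour (x, y)) (h (x, y + 1)) (h (x + 1, y + 1))}

lemma neg_colour_eq_or (c : Cell) : -colour c = 1 ∨ -colour c = -1 := by
  rcases colour_eq_or c with h | h <;> omega

lemma inf_mem_realHeights {t₀ : Tiling R} {h k : Vertex → ℝ} (hh : h ∈ realHeights t₀)
    (hk : k ∈ realHeights t₀) : (fun v => min (h v) (k v)) ∈ realHeights t₀ :=
  ⟨fun v hv => by dsimp only; rw [hh.1 v hv, hk.1 v hv, min_self], fun x y =>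
    ⟨(hh.2 x y).1.min (colour_eq_or _) (hk.2 x y).1,
      (hh.2 x y).2.min (neg_colour_eq_or _) (hk.2 x y).2⟩⟩

lemma sup_mem_realHeights {t₀ : Tiling R} {h k : Vertex → ℝ} (hh : h ∈ realHeights t₀)
    (hk : k ∈ realHeights t₀) : (fun v => max (h v) (k v)) ∈ realHeights t₀ :=
  ⟨fun v hv => by dsimp only; rw [hh.1 v hv, hk.1 v hv, max_self], fun x y =>
    ⟨(hh.2 x y).1.max (colour_eq_or _) (hk.2 x y).1,
      (hh.2 x y).2.max (neg_colour_eq_or _) (hk.2 x y).2⟩⟩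

lemma ind_hd_eq (t t₀ : Tiling R) (x y : ℤ) : t.ind (hd x y) =
    t₀.ind (hd x y) + colour (x, y) * (diff t t₀ (x + 1, y + 1) - diff t t₀ (x + 1, y)) := by
  have h := diff_north t t₀ (x + 1) y
  have hc := colour_mul_self (x, y)
  rw [add_sub_cancel_right, colour_east] at h
  linear_combination (-colour (x, y)) * h + (t₀.ind (hd x y) - t.ind (hd x y)) * hc

lemma ind_vd_eq (t t₀ : Tiling R) (x y : ℤ) : t.ind (vd x y) =
    t₀.ind (vd x y) + -colour (x, y) * (diff t t₀ (x + 1, y + 1) - diff t t₀ (x, y + 1)) := by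
  have h := diff_east t t₀ x (y + 1)
  have hc := colour_mul_self (x, y)
  rw [add_sub_cancel_right, colour_north] at h
  linear_combination colour (x, y) * h + (t₀.ind (vd x y) - t.ind (vd x y)) * hc

lemma ind_hd_eq_or (t t₀ : Tiling R) (x y : ℤ) :
    t₀.ind (hd x y) + colour (x, y) * (diff t t₀ (x + 1, y + 1) - diff t t₀ (x + 1, y)) = 0 ∨
    t₀.ind (hd x y) + colour (x, y) * (diff t t₀ (x + 1, y + 1) - diff t t₀ (x + 1, y)) = 1 := by
  rw [← ind_hd_eq]
  exact t.ind_eq_or _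

lemma ind_vd_eq_or (t t₀ : Tiling R) (x y : ℤ) :
    t₀.ind (vd x y) + -colour (x, y) * (diff t t₀ (x + 1, y + 1) - diff t t₀ (x, y + 1)) = 0 ∨
    t₀.ind (vd x y) + -colour (x, y) * (diff t t₀ (x + 1, y + 1) - diff t t₀ (x, y + 1)) = 1 := by
  rw [← ind_vd_eq]
  exact t.ind_eq_or _

lemma SameBoundary.mem_realHeights {t t₀ : Tiling R} (h : SameBoundary t t₀) :
    (fun v => (diff t t₀ v : ℝ)) ∈ realHeights t₀ :=
  ⟨fun v hv => by simp [h v hv], fun x y =>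
    ⟨edgeOK_intCast (ind_hd_eq_or t t₀ x y), edgeOK_intCast (ind_vd_eq_or t t₀ x y)⟩⟩

/-- Every rounding of a real height function is the height function of a tiling. -/
lemma exists_tiling_of_round {t₀ : Tiling R} {h : Vertex → ℝ} (hh : h ∈ realHeights t₀)
    {n : Vertex → ℤ} (hn : ∀ v, ⌊h v⌋ ≤ n v) (hn' : ∀ v, n v ≤ ⌈h v⌉) :
    ∃ t : Tiling R, SameBoundary t t₀ ∧ diff t t₀ = n := by
  have hv : VanishesOutside R n := by
    intro v hv
    have h1 := hn v
    have h2 := hn' v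
    rw [hh.1 v hv] at h1 h2
    simp at h1 h2
    omega
  obtain ⟨t, ht⟩ := exists_tiling_of_height t₀ hv (by
    intro d
    by_cases hdom : IsDomino d
    · obtain ⟨x, y, rfl | rfl⟩ := isDomino_iff.1 hdom
      · rw [hv.coboundary_hd]
        exact (hh.2 x y).1.round (colour_eq_or _) (hn _) (hn' _) (hn _) (hn' _)
      · rw [hv.coboundary_vd]
        exact (hh.2 x y).2.round (neg_colour_eq_or _) (hn _) (hn' _) (hn _) (hn' _)
    · rw [coboundary_eq_zero_of_not_isDomino _ hdom, add_zero]
      exact t₀.ind_eq_or d)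
  exact ⟨t, by rwa [SameBoundary, ht], ht⟩

instance : Finite (Tiling R) := by
  refine Finite.of_injective (β := R.powerset.powerset)
    (fun t => ⟨t.dominoes, Finset.mem_powerset.2 fun d hd =>
      Finset.mem_powerset.2 (t.subset d hd)⟩) ?_
  intro t t' h
  exact Tiling.ext (congrArg Subtype.val h)

/-- A tiling of greatest total height works: its maximum with any other admissible tiling is
integral and admissible, hence again a tiling, and would have a larger total if it differed. -/
lemma exists_top (t₀ : Tiling R) : ∃ T : Tiling R, SameBoundary T t₀ ∧
    ∀ t, SameBoundary t t₀ → ∀ v, diff t t₀ v ≤ diff T t₀ v := by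
  obtain ⟨T, hT, hmax⟩ := Set.exists_max_image {t : Tiling R | SameBoundary t t₀}
    (fun t => ∑ v ∈ R, diff t t₀ v) (Set.toFinite _) ⟨t₀, SameBoundary.refl _⟩
  refine ⟨T, hT, fun t ht => ?_⟩
  have hsup := sup_mem_realHeights hT.mem_realHeights ht.mem_realHeights
  obtain ⟨s, hs, hds⟩ := exists_tiling_of_round hsup
    (n := fun v => max (diff T t₀ v) (diff t t₀ v))
    (fun v => by rw [← Int.cast_max, Int.floor_intCast])
    (fun v => by rw [← Int.cast_max, Int.ceil_intCast])
  have hle := hmax s hs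
  rw [hds] at hle
  intro v
  by_contra hlt
  have hv : v ∈ R := by
    by_contra hv
    rw [hT v fun h => hv h.1, ht v fun h => hv h.1] at hlt
    exact hlt le_rfl
  have := Finset.sum_lt_sum (s := R) (f := fun v => diff T t₀ v)
    (g := fun v => max (diff T t₀ v) (diff t t₀ v)) (fun v _ => le_max_left _ _)
    ⟨v, hv, lt_max_of_lt_right (not_le.1 hlt)⟩
  exact absurd hle (not_le.2 this)

lemma exists_bottom (t₀ : Tiling R) : ∃ B : Tiling R, SameBoundary B t₀ ∧
    ∀ t, SameBoundary t t₀ → ∀ v, diff B t₀ v ≤ diff t t₀ v := by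
  obtain ⟨B, hB, hmin⟩ := Set.exists_min_image {t : Tiling R | SameBoundary t t₀}
    (fun t => ∑ v ∈ R, diff t t₀ v) (Set.toFinite _) ⟨t₀, SameBoundary.refl _⟩
  refine ⟨B, hB, fun t ht => ?_⟩
  have hinf := inf_mem_realHeights hB.mem_realHeights ht.mem_realHeights
  obtain ⟨s, hs, hds⟩ := exists_tiling_of_round hinf
    (n := fun v => min (diff B t₀ v) (diff t t₀ v))
    (fun v => by rw [← Int.cast_min, Int.floor_intCast])
    (fun v => by rw [← Int.cast_min, Int.ceil_intCast])
  have hle := hmin s hs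
  rw [hds] at hle
  intro v
  by_contra hlt
  have hv : v ∈ R := by
    by_contra hv
    rw [hB v fun h => hv h.1, ht v fun h => hv h.1] at hlt
    exact hlt le_rfl
  have := Finset.sum_lt_sum (s := R) (g := fun v => diff B t₀ v)
    (f := fun v => min (diff B t₀ v) (diff t t₀ v)) (fun v _ => min_le_left _ _)
    ⟨v, hv, min_lt_of_right_lt (not_le.1 hlt)⟩
  exact absurd hle (not_le.2 this)

/-! ### Cubes and real height functions -/

lemma potential_sum {A ι : Type*} [CommRing A] (S : Finset ι) (z : ι → Finset Cell → A) :
    potential R (∑ i ∈ S, z i) = ∑ i ∈ S, potential R (z i) := by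
  classical
  induction S using Finset.induction_on with
  | empty => funext v; simp [potential]
  | insert i S hi ih => rw [Finset.sum_insert hi, Finset.sum_insert hi, potential_add, ih]

lemma potential_point_sub (t t' : Tiling R) :
    potential R (t.point - t'.point) = fun v => (diff t t' v : ℝ) := by
  funext v
  simp [potential, diff, Tiling.point_apply]

lemma potential_cellMap (t t₀ : Tiling R) (S : Finset (Tiling R)) (a : Tiling R → ℝ) :
    potential R (cellMap t S a - t₀.point) =
      fun v => (diff t t₀ v : ℝ) + ∑ t' ∈ S, a t' * (diff t' t v : ℝ) := by
  have : cellMap t S a - t₀.point =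
      (t.point - t₀.point) + ∑ t' ∈ S, a t' • (t'.point - t.point) := by
    unfold cellMap; abel
  rw [this, potential_add, potential_sum, potential_point_sub]
  funext v
  simp [potential_smul, potential_point_sub, Finset.sum_apply]

lemma isCirculation_point_sub (t t' : Tiling R) : IsCirculation R (t.point - t'.point) := by
  have h := isCirculation_ind_sub t t'
  constructor
  · intro d hd
    refine h.supported d fun h' => hd ?_
    rw [Pi.sub_apply] at h' ⊢
    rw [Tiling.point_apply, Tiling.point_apply, ← Int.cast_sub, h', Int.cast_zero]
  · intro x y
    have := h.cellSum_eq_zero x y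
    unfold cellSum at *
    simp only [Pi.sub_apply, Tiling.point_apply] at *
    exact_mod_cast this

lemma IsCirculation.add {A : Type*} [CommRing A] {z w : Finset Cell → A} (hz : IsCirculation R z)
    (hw : IsCirculation R w) : IsCirculation R (z + w) := by
  constructor
  · intro d h
    by_cases h0 : z d = 0
    · exact hw.supported d fun h' => h (by simp [h0, h'])
    · exact hz.supported d h0
  · intro x y
    have h1 := hz.cellSum_eq_zero x y
    have h2 := hw.cellSum_eq_zero x y
    unfold cellSum at *
    simp only [Pi.add_apply]
    linear_combination h1 + h2

lemma IsCirculation.smul {A : Type*} [CommRing A] {z : Finset Cell → A} (hz : IsCirculation R z)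
    (a : A) : IsCirculation R (a • z) := by
  constructor
  · intro d h
    exact hz.supported d fun h' => h (by simp [h'])
  · intro x y
    have h1 := hz.cellSum_eq_zero x y
    unfold cellSum at *
    simp only [Pi.smul_apply, smul_eq_mul]
    linear_combination a * h1

lemma isCirculation_cellMap_sub (t t₀ : Tiling R) (S : Finset (Tiling R)) (a : Tiling R → ℝ) :
    IsCirculation R (cellMap t S a - t₀.point) := by
  classical
  have hsum : IsCirculation R (∑ t' ∈ S, a t' • (t'.point - t.point)) := by
    induction S using Finset.induction_on with
    | empty => exact ⟨fun d hd => absurd rfl hd, fun x y => by simp [cellSum]⟩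
    | insert i S hi ih =>
      rw [Finset.sum_insert hi]
      exact ((isCirculation_point_sub i t).smul _).add ih
  have : cellMap t S a - t₀.point =
      (t.point - t₀.point) + ∑ t' ∈ S, a t' • (t'.point - t.point) := by
    unfold cellMap; abel
  rw [this]
  exact (isCirculation_point_sub t t₀).add hsum

/-- The dominoes lifted in either direction of the flip cover the same four squares. -/
lemma IsFlip.mem_flipSquare {a b : ℤ} {t t' : Tiling R} (h : IsFlip (a, b) t t') {c : Cell}
    (hc : c = (a, b) ∨ c = (a + 1, b) ∨ c = (a, b + 1) ∨ c = (a + 1, b + 1)) :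
    c ∈ flipSquare t t' ∧ c ∈ flipSquare t' t := by
  have key : ∀ (s s' : Tiling R) (d : Finset Cell), s.ind d - s'.ind d = 1 → c ∈ d →
      c ∈ flipSquare s s' := by
    intro s s' d h1 h2
    refine Finset.mem_biUnion.2 ⟨d, Finset.mem_sdiff.2 ⟨?_, ?_⟩, h2⟩
    · rw [← Tiling.ind_eq_one]
      rcases s.ind_eq_or d with h | h <;> rcases s'.ind_eq_or d with h' | h' <;> omega
    · rw [← Tiling.ind_eq_zero]
      rcases s.ind_eq_or d with h | h <;> rcases s'.ind_eq_or d with h' | h' <;> omega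
  have i1 := h.ind (hd a b)
  have i2 := h.ind (hd a (b + 1))
  have i3 := h.ind (vd a b)
  have i4 := h.ind (vd (a + 1) b)
  simp only [hd_ne_vd, vd_ne_hd, hd_inj, vd_inj, or_self, true_or, or_true, if_true,
    if_false] at i1 i2 i3 i4
  rcases hc with rfl | rfl | rfl | rfl
  · exact ⟨key t t' (hd a b) (by omega) (by simp [mem_hd]),
      key t' t (vd a b) (by omega) (by simp [mem_vd])⟩
  · exact ⟨key t t' (hd a b) (by omega) (by simp [mem_hd]),
      key t' t (vd (a + 1) b) (by omega) (by simp [mem_vd])⟩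
  · exact ⟨key t t' (hd a (b + 1)) (by omega) (by simp [mem_hd]),
      key t' t (vd a b) (by omega) (by simp [mem_vd])⟩
  · exact ⟨key t t' (hd a (b + 1)) (by omega) (by simp [mem_hd]),
      key t' t (vd (a + 1) b) (by omega) (by simp [mem_vd])⟩

/-- The unit squares around the vertex moved by a flip belong to its 2 × 2 square. -/
lemma mem_flipSquare_of_adj {t t' : Tiling R} (h : (flipGraph R).Adj t t') {x y : ℤ}
    (hv : diff t' t (x + 1, y + 1) ≠ 0) {c : Cell}
    (hc : c = (x, y) ∨ c = (x + 1, y) ∨ c = (x, y + 1) ∨ c = (x + 1, y + 1)) :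
    c ∈ flipSquare t t' := by
  have hrel : t ≠ t' ∧ ((∃ c, IsFlip c t t') ∨ ∃ c, IsFlip c t' t) :=
    (SimpleGraph.fromRel_adj _ _ _).1 h
  have hsame : ∀ {a b k : ℤ}, (Pi.single (a + 1, b + 1) k : Vertex → ℤ) (x + 1, y + 1) ≠ 0 →
      x = a ∧ y = b := by
    intro a b k h
    by_contra hne
    refine h (Pi.single_eq_of_ne (fun h' => hne ?_) _)
    simpa using h'
  rcases hrel.2 with ⟨⟨a, b⟩, hf⟩ | ⟨⟨a, b⟩, hf⟩
  · rw [(isFlip_iff.1 hf).2] at hv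
    obtain ⟨rfl, rfl⟩ := hsame hv
    exact (hf.mem_flipSquare hc).1
  · rw [diff_swap, (isFlip_iff.1 hf).2, Pi.neg_apply] at hv
    obtain ⟨rfl, rfl⟩ := hsame (neg_ne_zero.1 hv)
    exact (hf.mem_flipSquare hc).2

lemma diff_eq_zero_or_of_adj {t t' : Tiling R} (h : (flipGraph R).Adj t t') {v w : Vertex}
    (hvw : v ≠ w) : diff t' t v = 0 ∨ diff t' t w = 0 := by
  obtain ⟨u, _, hu | hu⟩ := flipGraph_adj_iff.1 h <;> rw [hu] <;>
  · by_cases hv : v = u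
    · right
      exact Pi.single_eq_of_ne (fun hw => hvw (hv.trans hw.symm)) _
    · left
      exact Pi.single_eq_of_ne hv _

/-- Both ends of the edge crossed by `hd x y` or `vd x y` are corners of the square `(x, y)`. Two
flips moving ends of the same edge would both act on that square, so independence lets at most one
coordinate of the cube affect each edge. -/
lemma cellMap_mem_realHeights {t t₀ : Tiling R} (hs : SameBoundary t t₀) {S : Finset (Tiling R)}
    (hS : IndependentFlips t S) {a : Tiling R → ℝ} (ha : ∀ t', a t' ∈ Set.Icc (0 : ℝ) 1) :
    potential R (cellMap t S a - t₀.point) ∈ realHeights t₀ := by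
  rw [potential_cellMap]
  have huniq : ∀ i ∈ S, ∀ j ∈ S, ∀ c : Cell, c ∈ flipSquare t i → c ∈ flipSquare t j → i = j := by
    intro i hi j hj c h1 h2
    by_contra hne
    exact Finset.disjoint_left.1 (hS.2 hi hj hne) h1 h2
  have hmem : ∀ i ∈ S, ∀ x y : ℤ, diff i t (x, y) ≠ 0 → ∀ c : Cell,
      c = (x - 1, y - 1) ∨ c = (x, y - 1) ∨ c = (x - 1, y) ∨ c = (x, y) → c ∈ flipSquare t i := by
    intro i hi x y h c hc
    refine mem_flipSquare_of_adj (hS.1 i hi) (x := x - 1) (y := y - 1) ?_ ?_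
    · rwa [sub_add_cancel, sub_add_cancel]
    · rwa [sub_add_cancel, sub_add_cancel]
  refine ⟨fun v hv => ?_, fun x y => ⟨?_, ?_⟩⟩
  · dsimp only
    rw [hs v hv, Finset.sum_eq_zero, Int.cast_zero, add_zero]
    intro i hi
    rw [(SameBoundary.of_reachable (hS.1 i hi).reachable).symm v hv]
    simp
  · refine edgeOK_of_sum S a ha _ _ (ind_hd_eq_or t t₀ x y) ?_ ?_ ?_
    · intro i _
      rw [add_comm (diff t t₀ _), add_comm (diff t t₀ _), diff_add_apply, diff_add_apply]
      exact ind_hd_eq_or i t₀ x y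
    · exact fun i hi => diff_eq_zero_or_of_adj (hS.1 i hi) (by simp)
    · intro i hi j hj h1 h2
      refine huniq i hi j hj (x, y) ?_ ?_
      · rcases h1 with h1 | h1 <;> exact hmem i hi _ _ h1 _ (by simp)
      · rcases h2 with h2 | h2 <;> exact hmem j hj _ _ h2 _ (by simp)
  · refine edgeOK_of_sum S a ha _ _ (ind_vd_eq_or t t₀ x y) ?_ ?_ ?_
    · intro i _
      rw [add_comm (diff t t₀ _), add_comm (diff t t₀ _), diff_add_apply, diff_add_apply]
      exact ind_vd_eq_or i t₀ x y
    · exact fun i hi => diff_eq_zero_or_of_adj (hS.1 i hi) (by simp)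
    · intro i hi j hj h1 h2
      refine huniq i hi j hj (x, y) ?_ ?_
      · rcases h1 with h1 | h1 <;> exact hmem i hi _ _ h1 _ (by simp)
      · rcases h2 with h2 | h2 <;> exact hmem j hj _ _ h2 _ (by simp)

lemma point_add_coboundary_potential {t t₀ : Tiling R} (hs : SameBoundary t t₀)
    {S : Finset (Tiling R)} (hS : IndependentFlips t S) {a : Tiling R → ℝ}
    (ha : ∀ t', a t' ∈ Set.Icc (0 : ℝ) 1) :
    t₀.point + coboundary R (potential R (cellMap t S a - t₀.point)) = cellMap t S a := by
  rw [(isCirculation_cellMap_sub t t₀ S a).coboundary_potential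
    (cellMap_mem_realHeights hs hS ha).1]
  abel

lemma exists_of_coboundary_single_ne_zero {v : Vertex} (hv : IsInterior R v) {d : Finset Cell}
    (h : coboundary R (Pi.single v (1 : ℤ) : Vertex → ℤ) d ≠ 0) : ∃ x y,
      (d = hd x y ∧ (v = (x + 1, y) ∨ v = (x + 1, y + 1))) ∨
      (d = vd x y ∧ (v = (x, y + 1) ∨ v = (x + 1, y + 1))) := by
  have hvan := vanishesOutside_single hv (1 : ℤ)
  have hdom : IsDomino d := by
    by_contra h'
    exact h (coboundary_eq_zero_of_not_isDomino _ h')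
  obtain ⟨x, y, rfl | rfl⟩ := isDomino_iff.1 hdom
  · refine ⟨x, y, Or.inl ⟨rfl, ?_⟩⟩
    by_contra hne
    rw [not_or] at hne
    rw [hvan.coboundary_hd, Pi.single_eq_of_ne (Ne.symm hne.1),
      Pi.single_eq_of_ne (Ne.symm hne.2)] at h
    simp at h
  · refine ⟨x, y, Or.inr ⟨rfl, ?_⟩⟩
    by_contra hne
    rw [not_or] at hne
    rw [hvan.coboundary_vd, Pi.single_eq_of_ne (Ne.symm hne.1),
      Pi.single_eq_of_ne (Ne.symm hne.2)] at h
    simp at h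

/-- Every real height function is the height function of a point of a cube. -/
lemma exists_cell_of_mem_realHeights {t₀ : Tiling R} {h : Vertex → ℝ} (hh : h ∈ realHeights t₀) :
    ∃ (t : Tiling R) (S : Finset (Tiling R)) (a : Tiling R → ℝ), SameBoundary t t₀ ∧
      IndependentFlips t S ∧ (∀ t', a t' ∈ Set.Icc (0 : ℝ) 1) ∧
      potential R (cellMap t S a - t₀.point) = h := by
  classical
  -- The base vertex of the cube is the tiling obtained by rounding down everywhere.
  obtain ⟨t, ht, hdt⟩ := exists_tiling_of_round hh (n := fun v => ⌊h v⌋) (fun v => le_rfl)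
    (fun v => Int.floor_le_ceil _)
  have hint : ∀ v, ¬ IsInt (h v) → IsInterior R v := by
    intro v hv
    by_contra h'
    exact hv ⟨0, by simp [hh.1 v h']⟩
  have hex : ∀ v, ∃ s : Tiling R, ¬ IsInt (h v) → diff s t = Pi.single v 1 := by
    intro v
    by_cases hv : IsInt (h v)
    · exact ⟨t, fun h' => absurd hv h'⟩
    · have hceil : ⌊h v⌋ + 1 ≤ ⌈h v⌉ := by
        rw [Int.add_one_le_iff, Int.lt_ceil]
        exact lt_of_le_of_ne (Int.floor_le _) fun h' => hv ⟨_, h'⟩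
      obtain ⟨s, hs, hds⟩ := exists_tiling_of_round hh
        (n := (fun v => ⌊h v⌋) + Pi.single v 1)
        (fun w => by
          by_cases hw : w = v
          · subst hw; simp
          · simp [hw])
        (fun w => by
          by_cases hw : w = v
          · subst hw; simpa using hceil
          · simpa [hw] using Int.floor_le_ceil _)
      refine ⟨s, fun _ => ?_⟩
      have := diff_add s t t₀
      rw [hds, hdt, add_comm] at this
      exact add_left_cancel this
  choose f hf using hex
  set V := R.filter fun v => ¬ IsInt (h v) with hV
  have hVf : ∀ v ∈ V, diff (f v) t = Pi.single v 1 := fun v hv => hf v (Finset.mem_filter.1 hv).2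
  have hinj : Set.InjOn f V := by
    intro v hv w hw hvw
    have h1 := hVf v hv
    rw [hvw, hVf w hw] at h1
    by_contra hne
    have := congrFun h1 v
    rw [Pi.single_eq_same, Pi.single_eq_of_ne hne] at this
    exact zero_ne_one this
  have hfr : ∀ v ∈ V, Int.fract (∑ w ∈ V, (diff (f v) t w : ℝ) * h w) = Int.fract (h v) := by
    intro v hv
    rw [Finset.sum_eq_single_of_mem v hv]
    · simp [hVf v hv]
    · intro w _ hw
      simp [hVf v hv, hw]
  -- Coordinates must be given for all tilings, not for vertices. At `f v` the height difference to
  -- `t` is the indicator of `v`, so the sum returns `h v`; the fractional part lies in [0, 1] for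
  -- every tiling.
  refine ⟨t, V.image f, fun t' => Int.fract (∑ w ∈ V, (diff t' t w : ℝ) * h w), ht, ⟨?_, ?_⟩,
    fun t' => ⟨Int.fract_nonneg _, (Int.fract_lt_one _).le⟩, ?_⟩
  · intro t' ht'
    obtain ⟨v, hv, rfl⟩ := Finset.mem_image.1 ht'
    exact flipGraph_adj_iff.2 ⟨v, hint v (Finset.mem_filter.1 hv).2, Or.inl (hVf v hv)⟩
  · intro t' ht' t'' ht'' hne
    obtain ⟨v, hv, rfl⟩ := Finset.mem_image.1 (Finset.mem_coe.1 ht')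
    obtain ⟨w, hw, rfl⟩ := Finset.mem_image.1 (Finset.mem_coe.1 ht'')
    have hvw : v ≠ w := fun h' => hne (congrArg f h')
    have hv1 := (Finset.mem_filter.1 hv).2
    have hw1 := (Finset.mem_filter.1 hw).2
    have hcob : ∀ u ∈ V, ∀ d ∈ t.dominoes \ (f u).dominoes,
        coboundary R (Pi.single u (1 : ℤ) : Vertex → ℤ) d ≠ 0 := by
      intro u hu d hd'
      obtain ⟨h1, h2⟩ := Finset.mem_sdiff.1 hd'
      have hsb : SameBoundary (f u) t := by
        rw [SameBoundary, hVf u hu]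
        exact vanishesOutside_single (hint u (Finset.mem_filter.1 hu).2) _
      rw [← hVf u hu, hsb.coboundary_diff, Pi.sub_apply, Tiling.ind_eq_one.2 h1,
        Tiling.ind_eq_zero.2 h2]
      norm_num
    rw [Finset.disjoint_left]
    intro c hc hc'
    obtain ⟨d, hd1, hcd⟩ := Finset.mem_biUnion.1 hc
    obtain ⟨d', hd1', hcd'⟩ := Finset.mem_biUnion.1 hc'
    -- A common square lies in one domino of `t`, so both flips lift that domino. Then `v` and `w`
    -- are the two ends of the edge it crosses, both with non-integral heights, contrary to
    -- `EdgeOK`.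
    obtain rfl : d = d' := t.eq_of_mem (Finset.mem_sdiff.1 hd1).1 (Finset.mem_sdiff.1 hd1').1 hcd
      hcd'
    obtain ⟨x, y, h1⟩ := exists_of_coboundary_single_ne_zero (hint v hv1) (hcob v hv d hd1)
    obtain ⟨x', y', h2⟩ := exists_of_coboundary_single_ne_zero (hint w hw1) (hcob w hw d hd1')
    rcases h1 with ⟨rfl, h1⟩ | ⟨rfl, h1⟩
    · rcases h2 with ⟨h3, h2⟩ | ⟨h3, h2⟩
      · obtain ⟨rfl, rfl⟩ := hd_inj.1 h3
        have h4 := (hh.2 x y).1.2.2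
        rcases h1 with rfl | rfl <;> rcases h2 with rfl | rfl <;> tauto
      · exact hd_ne_vd h3
    · rcases h2 with ⟨h3, h2⟩ | ⟨h3, h2⟩
      · exact vd_ne_hd h3
      · obtain ⟨rfl, rfl⟩ := vd_inj.1 h3
        have h4 := (hh.2 x y).2.2.2
        rcases h1 with rfl | rfl <;> rcases h2 with rfl | rfl <;> tauto
  · rw [potential_cellMap]
    funext v
    rw [Finset.sum_image hinj, hdt]
    have hsum : ∑ w ∈ V, Int.fract (∑ u ∈ V, (diff (f w) t u : ℝ) * h u) *
        (diff (f w) t v : ℝ) = Int.fract (h v) := by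
      by_cases hv : v ∈ V
      · rw [Finset.sum_eq_single_of_mem v hv]
        · rw [hfr v hv, hVf v hv]
          simp
        · intro w hw hwv
          rw [hVf w hw]
          simp [hwv.symm]
      · rw [Finset.sum_eq_zero]
        · have : IsInt (h v) := by
            by_contra h'
            exact hv (Finset.mem_filter.2 ⟨(hint v h').1, h'⟩)
          obtain ⟨k, hk⟩ := this
          rw [← hk, Int.fract_intCast]
        · intro w hw
          have : v ≠ w := fun h' => hv (h' ▸ hw)
          rw [hVf w hw]
          simp [this]
    rw [hsum]
    exact Int.floor_add_fract (h v)

/-! ### Contractibility -/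

lemma continuous_potential : Continuous (potential R : (Finset Cell → ℝ) → Vertex → ℝ) := by
  unfold potential
  fun_prop

lemma continuous_coboundary : Continuous (coboundary R : (Vertex → ℝ) → Finset Cell → ℝ) := by
  refine continuous_pi fun d => continuous_finsetSum _ fun c _ => ?_
  split_ifs <;> fun_prop

lemma joinedIn_realHeights_of_adj {t₀ t s : Tiling R} (ht : SameBoundary t t₀)
    (h : (flipGraph R).Adj t s) : JoinedIn (realHeights t₀) (fun v => (diff t t₀ v : ℝ))
      (fun v => (diff s t₀ v : ℝ)) := by
  have hS : IndependentFlips t {s} := by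
    refine ⟨fun t' h' => by rwa [Finset.mem_singleton.1 h'], ?_⟩
    rw [Finset.coe_singleton]
    exact Set.pairwise_singleton _ _
  have hf : ∀ r : ℝ, potential R (cellMap t {s} (fun _ => r) - t₀.point) =
      fun v => (diff t t₀ v : ℝ) + r * (diff s t v : ℝ) := by
    intro r
    rw [potential_cellMap]
    simp
  refine JoinedIn.ofLine (f := fun r v => (diff t t₀ v : ℝ) + r * (diff s t v : ℝ)) ?_ ?_ ?_ ?_
  · fun_prop
  · simp
  · funext v
    rw [← diff_add_apply s t t₀]
    push_cast
    ring
  · rintro _ ⟨r, hr, rfl⟩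
    dsimp only
    rw [← hf]
    exact cellMap_mem_realHeights ht hS fun _ => hr

lemma joinedIn_realHeights {t₀ t s : Tiling R} (ht : SameBoundary t t₀) (hs : SameBoundary s t₀) :
    JoinedIn (realHeights t₀) (fun v => (diff t t₀ v : ℝ)) (fun v => (diff s t₀ v : ℝ)) := by
  obtain ⟨p⟩ := reachable_iff_sameBoundary.2 (ht.trans hs.symm)
  induction p with
  | nil => exact JoinedIn.refl ht.mem_realHeights
  | cons h p ih =>
    exact (joinedIn_realHeights_of_adj ht h).trans
      (ih ((SameBoundary.of_reachable h.reachable).symm.trans ht) hs)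

instance contractibleSpace_realHeights (t₀ : Tiling R) : ContractibleSpace (realHeights t₀) := by
  obtain ⟨T, hT, hTmax⟩ := exists_top t₀
  obtain ⟨B, hB, hBmin⟩ := exists_bottom t₀
  obtain ⟨γ, hγ⟩ := joinedIn_realHeights hT hB
  -- Rounding up gives a tiling above `h`, which lies below the top tiling; rounding down does the
  -- same for the bottom.
  have hle : ∀ h ∈ realHeights t₀, ∀ v, h v ≤ diff T t₀ v := by
    intro h hh v
    obtain ⟨s, hs, hds⟩ := exists_tiling_of_round hh (n := fun v => ⌈h v⌉)
      (fun v => Int.floor_le_ceil _) (fun v => le_rfl)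
    have := hTmax s hs v
    rw [hds] at this
    exact (Int.le_ceil _).trans (by exact_mod_cast this)
  have hge : ∀ h ∈ realHeights t₀, ∀ v, diff B t₀ v ≤ h v := by
    intro h hh v
    obtain ⟨s, hs, hds⟩ := exists_tiling_of_round hh (n := fun v => ⌊h v⌋) (fun v => le_rfl)
      (fun v => Int.floor_le_ceil _)
    have := hBmin s hs v
    rw [hds] at this
    exact le_trans (by exact_mod_cast this) (Int.floor_le _)
  rw [contractible_iff_id_nullhomotopic]
  -- The minimum with `γ` stays in the set by the lattice property. At the top it is the identity,
  -- at the bottom it is constant.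
  refine ⟨⟨_, hB.mem_realHeights⟩, ⟨⟨⟨fun p => ⟨fun v => min (p.2.1 v) (γ p.1 v),
    inf_mem_realHeights p.2.2 (hγ p.1)⟩, ?_⟩, ?_, ?_⟩⟩⟩
  · refine Continuous.subtype_mk (continuous_pi fun v => ?_) _
    have h1 : Continuous fun p : unitInterval × realHeights t₀ => p.2.1 v :=
      (continuous_apply v).comp (continuous_subtype_val.comp continuous_snd)
    have h2 : Continuous fun p : unitInterval × realHeights t₀ => γ p.1 v :=
      (continuous_apply v).comp (γ.continuous.comp continuous_fst)
    exact h1.min h2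
  · intro h
    refine Subtype.ext (funext fun v => ?_)
    simp only [γ.source, ContinuousMap.id_apply]
    exact min_eq_left (hle h.1 h.2 v)
  · intro h
    refine Subtype.ext (funext fun v => ?_)
    simp only [γ.target, ContinuousMap.const_apply]
    exact min_eq_right (hge h.1 h.2 v)

/-- The point of the complex with a given height function. -/
noncomputable def complexPoint (t₀ : Tiling R) (h : Vertex → ℝ) : Finset Cell → ℝ :=
  t₀.point + coboundary R h

lemma continuous_complexPoint (t₀ : Tiling R) : Continuous (complexPoint t₀) :=
  continuous_const.add continuous_coboundary

lemma complexPoint_mem {t₀ : Tiling R} {h : Vertex → ℝ} (hh : h ∈ realHeights t₀) :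
    complexPoint t₀ h ∈ flipComplex R := by
  obtain ⟨t, S, a, ht, hS, ha, rfl⟩ := exists_cell_of_mem_realHeights hh
  exact ⟨t, S, hS, a, ha, (point_add_coboundary_potential ht hS ha).symm⟩

lemma potential_cellMap_of_not_isInterior {t : Tiling R} (t₀ : Tiling R) {S : Finset (Tiling R)}
    (hS : IndependentFlips t S) (a : Tiling R → ℝ) {v : Vertex} (hv : ¬ IsInterior R v) :
    potential R (cellMap t S a - t₀.point) v = diff t t₀ v := by
  rw [potential_cellMap]
  dsimp only
  rw [Finset.sum_eq_zero, add_zero]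
  intro t' ht'
  rw [(SameBoundary.of_reachable (hS.1 t' ht').reachable).symm v hv]
  simp

/-- Along the boundary of `R`, heights are constant on connected components of the complex. -/
lemma potential_eq_of_mem_connectedComponent (t₀ : Tiling R) {x y : flipComplex R}
    (hy : y ∈ connectedComponent x) {v : Vertex} (hv : ¬ IsInterior R v) :
    potential R (y.1 - t₀.point) v = potential R (x.1 - t₀.point) v := by
  have hcont : Continuous fun z : flipComplex R => potential R (z.1 - t₀.point) v :=
    (continuous_apply v).comp
      (continuous_potential.comp (continuous_subtype_val.sub continuous_const))
  -- No cube moves a non-interior vertex, so heights there are integers; a continuous function with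
  -- discrete values is constant on a connected set.
  have hdisc : IsDiscrete (Set.range ((↑) : ℤ → ℝ)) :=
    Int.isClosedEmbedding_coe_real.isInducing.isDiscrete_range
  refine isPreconnected_connectedComponent.constant_of_mapsTo hdisc hcont.continuousOn ?_ hy
    mem_connectedComponent
  rintro ⟨_, t, S, hS, a, _, rfl⟩ _
  exact ⟨diff t t₀ v, (potential_cellMap_of_not_isInterior t₀ hS a hv).symm⟩

/-- Take `t₀` from a cube containing `x`. Passing to heights and back is the identity on the
component of `x`. The image of the connected set `realHeights t₀` contains `x`, so it stays in that
component. Hence the identity factors through a contractible space and is nullhomotopic. -/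
lemma contractibleSpace_connectedComponent (x : flipComplex R) :
    ContractibleSpace (connectedComponent x) := by
  obtain ⟨t₀, S₀, hS₀, a₀, ha₀, hx⟩ := x.2
  have hcell : ∀ y ∈ connectedComponent x, ∃ (t : Tiling R) (S : Finset (Tiling R))
      (a : Tiling R → ℝ), SameBoundary t t₀ ∧ IndependentFlips t S ∧
        (∀ t', a t' ∈ Set.Icc (0 : ℝ) 1) ∧ cellMap t S a = y.1 := by
    intro y hy
    obtain ⟨t, S, hS, a, ha, hy'⟩ := y.2
    refine ⟨t, S, a, fun v hv => ?_, hS, ha, hy'⟩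
    have h := potential_eq_of_mem_connectedComponent t₀ hy hv
    rw [← hx, ← hy', potential_cellMap_of_not_isInterior t₀ hS a hv,
      potential_cellMap_of_not_isInterior t₀ hS₀ a₀ hv, diff_self] at h
    exact_mod_cast h
  have hmem : ∀ y ∈ connectedComponent x, potential R (y.1 - t₀.point) ∈ realHeights t₀ := by
    intro y hy
    obtain ⟨t, S, a, ht, hS, ha, hy'⟩ := hcell y hy
    rw [← hy']
    exact cellMap_mem_realHeights ht hS ha
  have hleft : ∀ y ∈ connectedComponent x,
      complexPoint t₀ (potential R (y.1 - t₀.point)) = y.1 := by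
    intro y hy
    obtain ⟨t, S, a, ht, hS, ha, hy'⟩ := hcell y hy
    rw [← hy']
    exact point_add_coboundary_potential ht hS ha
  let g : realHeights t₀ → flipComplex R := fun h => ⟨complexPoint t₀ h.1, complexPoint_mem h.2⟩
  have hg : Continuous g :=
    ((continuous_complexPoint t₀).comp continuous_subtype_val).subtype_mk _
  have hxg : x ∈ Set.range g :=
    ⟨⟨_, hmem x mem_connectedComponent⟩, Subtype.ext (hleft x mem_connectedComponent)⟩
  have hgmem : ∀ h, g h ∈ connectedComponent x := fun h =>
    (isPreconnected_range hg).subset_connectedComponent hxg ⟨h, rfl⟩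
  let Φ : C(realHeights t₀, connectedComponent x) :=
    ⟨fun h => ⟨g h, hgmem h⟩, hg.subtype_mk _⟩
  let Ψ : C(connectedComponent x, realHeights t₀) :=
    ⟨fun y => ⟨potential R (y.1.1 - t₀.point), hmem y.1 y.2⟩,
      (continuous_potential.comp ((continuous_subtype_val.comp continuous_subtype_val).sub
        continuous_const)).subtype_mk _⟩
  have hid : Φ.comp ((ContinuousMap.id _).comp Ψ) = ContinuousMap.id (connectedComponent x) := by
    ext1 y
    exact Subtype.ext (Subtype.ext (hleft y.1 y.2))
  rw [contractible_iff_id_nullhomotopic, ← hid]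
  exact ((id_nullhomotopic (realHeights t₀)).comp_left Ψ).comp_right Φ

end DominoFlip

theorem theorem3p4 (R : Finset Cell) :
    -- same component of the flip graph iff same flow across all cuts
    (∀ t₁ t₂ : Tiling R, (flipGraph R).Reachable t₁ t₂ ↔
      ∀ (u v : Vertex) (p : (edgeGraph R).Walk u v), IsCut p → t₁.flow p = t₂.flow p) ∧
    -- all tilings have height sections in one bundle, equal on the boundary within a component
    (∃ (L : HeightBundle R) (θ : Tiling R → Vertex → ℤ),
      (∀ t, IsHeightSection L t (θ t)) ∧
      ∀ t₁ t₂, (flipGraph R).Reachable t₁ t₂ → ∀ v, IsBoundaryVertex R v → θ t₁ v = θ t₂ v) ∧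
    -- the distance formula
    (∀ t₁ t₂ : Tiling R, (flipGraph R).Reachable t₁ t₂ →
      ∀ (L : HeightBundle R) (θ₁ θ₂ : Vertex → ℤ),
        IsHeightSection L t₁ θ₁ → IsHeightSection L t₂ θ₂ →
        (∀ v, IsBoundaryVertex R v → θ₁ v = θ₂ v) →
        ((flipGraph R).dist t₁ t₂ : ℚ) =
          1 / 4 * ∑ v ∈ vertices R, |(θ₁ v : ℚ) - (θ₂ v : ℚ)|) ∧
    -- the connected components of the complex are contractible
    (∀ x : flipComplex R, ContractibleSpace (connectedComponent x)) := by
  refine ⟨fun t₁ t₂ => reachable_iff_sameBoundary.trans sameBoundary_iff_flow_eq,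
    exists_bundle_sections R, fun t₁ t₂ h L θ₁ θ₂ h₁ h₂ hb =>
      dist_eq_sum_sections (reachable_iff_sameBoundary.1 h) h₁ h₂ hb,
    contractibleSpace_connectedComponent⟩
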